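/- Let $K$ be a field and let $S$ be a polynomial ring over $K$ in finitely many variables with the standard grading. For a homogeneous ideal $I\subseteq S$ let $\beta_{i,j}(I)=\dim_K \operatorname{Tor}_i^S(I,K)_j$ denote its graded Betti numbers ($K=S/\mathfrak m$, with $\mathfrak m$ generated by the variables). Let $h\ge 1$, and let $\mathfrak p(h)\subseteq \mathbb R[y_1,\dots,y_h,z_1,\dots,z_h]$ be the kernel of the $\mathbb R$-algebra homomorphism to $\mathbb C[x_1,\dots,x_h]$ given by $y_j\mapsto x_j$, $z_j\mapsto \mathrm i\,x_j$, whose image is $\mathbb R[x_j,\mathrm i x_j \mid j=1,\dots,h]$. Then $\mathfrak p(h)$ is a homogeneous prime ideal of height $h$, and $$\beta_{i,i+2}(\mathfrak p(h))=\binom{2h}{i+2}-2\binom{h}{i+2}\qquad\text{for all } i\ge 0 .$$ So the upper bound $\beta_{i,i+2}(I)\le\binom{2h}{i+2}-2\binom{h}{i+2}$ for homogeneous unmixed radical ideals $I$ of height $h$, whose validity is a separate theorem and not part of the claim here, is attained, for all $i\ge0$ simultaneously, by a homogeneous prime ideal of height $h$. Moreover, there is a $\mathbb C$-algebra isomorphism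 $\mathbb C[y_1,\dots,y_h,z_1,\dots,z_h]\cong\mathbb C[u_1,\dots,u_h,v_1,\dots,v_h]$ with $y_j+\mathrm i z_j\mapsto u_j$ and $y_j-\mathrm i z_j\mapsto v_j$ that takes the extension $\mathfrak p(h)\,\mathbb C[y_1,\dots,y_h,z_1,\dots,z_h]$ to $\Gamma(h)=(u_1,\dots,u_h)(v_1,\dots,v_h)$, and $\Gamma(h)$ has a linear resolution: $\beta_{i,j}(\Gamma(h))=0$ whenever $j\neq i+2$. -/

import Mathlib

open MvPolynomial

attribute [local instance] MvPolynomial.gradedAlgebra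

/-! ## Graded free resolutions and graded Betti numbers

`MvPolynomial σ K` carries the standard grading (every variable has degree one). -/

/-- `f` is homogeneous of degree `k`, for an integer `k` (for `k < 0` this forces `f = 0`). -/
def HasDegree {σ K : Type*} [Field K] (f : MvPolynomial σ K) (k : ℤ) : Prop :=
  ∀ m ∈ f.support, (m.degree : ℤ) = k

/-- A graded free resolution
`⋯ → ⨁_a S(-deg 1 a) → ⨁_a S(-deg 0 a) → I → 0` of an ideal `I` of `S = MvPolynomial σ K`
by free modules of finite rank: the `n`-th free module `F_n` has a homogeneous basis with
`rank n` elements, the `a`-th one in degree `deg n a`; the augmentation `F_0 → I` sends the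
`a`-th basis element to `gen a`; the differential `F_{n+1} → F_n` is given by the matrix `d n`.
All these maps preserve degrees. -/
structure GradedFreeResolution {σ K : Type*} [Field K] (I : Ideal (MvPolynomial σ K)) where
  rank : ℕ → ℕ
  deg : ∀ n, Fin (rank n) → ℤ
  gen : Fin (rank 0) → MvPolynomial σ K
  d : ∀ n, Matrix (Fin (rank n)) (Fin (rank (n + 1))) (MvPolynomial σ K)
  gen_hasDegree : ∀ a, HasDegree (gen a) (deg 0 a)
  d_hasDegree : ∀ n a b, HasDegree (d n a b) (deg (n + 1) b - deg n a)
  span_gen : Ideal.span (Set.range gen) = I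
  exact_gen : Function.Exact (d 0).mulVec (fun v => gen ⬝ᵥ v)
  exact_d : ∀ n, Function.Exact (d (n + 1)).mulVec (d n).mulVec

namespace GradedFreeResolution

variable {σ K : Type*} [Field K] {I : Ideal (MvPolynomial σ K)} (F : GradedFreeResolution I)

/-- The degree `j` part of `F_n ⊗_S K`, where `K = S / (variables)`: it has as a `K`-basis the
basis elements of `F_n` of degree `j`. -/
abbrev Strand (n : ℕ) (j : ℤ) : Type _ := {a : Fin (F.rank n) // F.deg n a = j} → K

/-- The degree `j` part of the differential `F_{n+1} ⊗_S K → F_n ⊗_S K`, whose matrix consists of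
the constant terms of the entries of `d n`. -/
noncomputable def strandD (n : ℕ) (j : ℤ) : F.Strand (n + 1) j →ₗ[K] F.Strand n j :=
  (((F.d n).map (constantCoeff (σ := σ) (R := K))).submatrix
    Subtype.val Subtype.val).mulVecLin

/-- The degree `j` cycles of the complex `F ⊗_S K` in homological degree `i`. -/
noncomputable def cycles : ∀ (i : ℕ) (j : ℤ), Submodule K (F.Strand i j)
  | 0, _ => ⊤
  | n + 1, j => LinearMap.ker (F.strandD n j)

/-- The degree `j` boundaries of the complex `F ⊗_S K` in homological degree `i`. -/
noncomputable def boundaries (i : ℕ) (j : ℤ) : Submodule K (F.Strand i j) :=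
  LinearMap.range (F.strandD i j)

/-- `Tor_i^S(I, K)_j = H_i(F ⊗_S K)_j`. -/
abbrev Tor (i : ℕ) (j : ℤ) : Type _ :=
  F.cycles i j ⧸ (F.boundaries i j).submoduleOf (F.cycles i j)

end GradedFreeResolution

/-! ### Existence of graded free resolutions -/

section Existence

variable {σ K : Type*} [Field K]

/-- The component of degree `k` of a vector in a graded free module. -/
noncomputable def vecComponent {n : ℕ} (deg : Fin n → ℤ) (k : ℤ)
    (v : Fin n → MvPolynomial σ K) : Fin n → MvPolynomial σ K := fun a =>
  if deg a ≤ k then homogeneousComponent (k - deg a).toNat (v a) else 0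

lemma coeff_vecComponent {n : ℕ} (deg : Fin n → ℤ) (k : ℤ)
    (v : Fin n → MvPolynomial σ K) (a : Fin n) (m : σ →₀ ℕ) :
    coeff m (vecComponent deg k v a) =
      if (m.degree : ℤ) + deg a = k then coeff m (v a) else 0 := by
  unfold vecComponent
  split_ifs with h1 h2 h2
  · rw [coeff_homogeneousComponent, if_pos (by omega)]
  · rw [coeff_homogeneousComponent, if_neg (by omega)]
  · omega
  · simp

/-- Every homogeneous submodule of a graded free module of finite rank is the image of a
degree-preserving map from a graded free module of finite rank. -/
lemma exists_homogeneous_cover [Finite σ] {n : ℕ} (deg : Fin n → ℤ)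
    (N : Submodule (MvPolynomial σ K) (Fin n → MvPolynomial σ K))
    (hN : ∀ v ∈ N, ∀ k, vecComponent deg k v ∈ N) :
    ∃ (r : ℕ) (deg' : Fin r → ℤ) (M : Matrix (Fin n) (Fin r) (MvPolynomial σ K)),
      (∀ a b, HasDegree (M a b) (deg' b - deg a)) ∧ LinearMap.range M.mulVecLin = N := by
  classical
  set H : Set (Fin n → MvPolynomial σ K) :=
    {v | v ∈ N ∧ ∃ k : ℤ, ∀ a, HasDegree (v a) (k - deg a)} with hH
  have hspan : Submodule.span (MvPolynomial σ K) H = N := by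
    apply le_antisymm
    · rw [Submodule.span_le]
      exact fun v hv => hv.1
    · intro v hv
      let T : Finset ℤ := Finset.univ.biUnion fun a : Fin n =>
        (v a).support.image fun m => (m.degree : ℤ) + deg a
      have hsum : v = ∑ k ∈ T, vecComponent deg k v := by
        funext a
        ext m
        rw [Finset.sum_apply, coeff_sum]
        simp only [coeff_vecComponent]
        rw [Finset.sum_ite_eq]
        split_ifs with h
        · rfl
        · by_contra hne
          apply h
          simp only [T, Finset.mem_biUnion, Finset.mem_image, Finset.mem_univ, true_and]
          exact ⟨a, m, mem_support_iff.2 hne, rfl⟩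
      rw [hsum]
      refine Submodule.sum_mem _ fun k _ => Submodule.subset_span ⟨hN v hv k, k, ?_⟩
      intro a m hm
      rw [mem_support_iff, coeff_vecComponent] at hm
      have : (m.degree : ℤ) + deg a = k := by
        by_contra h
        simp [h] at hm
      omega
  have hfg : (Submodule.span (MvPolynomial σ K) H).FG := IsNoetherian.noetherian _
  rw [Submodule.fg_span_iff_fg_span_finset_subset] at hfg
  obtain ⟨s, hs, hs'⟩ := hfg
  have hs2 : ∀ b : Fin s.card, ∃ k : ℤ, ∀ a,
      HasDegree ((s.equivFin.symm b : Fin n → MvPolynomial σ K) a) (k - deg a) :=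
    fun b => (hs (s.equivFin.symm b).2).2
  choose deg' hdeg' using hs2
  refine ⟨s.card, deg', Matrix.of fun a b => (s.equivFin.symm b : Fin n → MvPolynomial σ K) a,
    fun a b => hdeg' b a, ?_⟩
  rw [Matrix.range_mulVecLin, ← hspan, hs']
  congr 1
  ext v
  simp only [Set.mem_range, Finset.mem_coe]
  constructor
  · rintro ⟨b, rfl⟩
    exact (s.equivFin.symm b).2
  · intro hv
    exact ⟨s.equivFin ⟨v, hv⟩, by ext1 a; simp [Matrix.col]⟩

/-- The kernel of a degree-preserving map is a homogeneous submodule. -/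
lemma vecComponent_mem_ker {p q : ℕ} {deg : Fin p → ℤ} {deg' : Fin q → ℤ}
    {M : Matrix (Fin p) (Fin q) (MvPolynomial σ K)}
    (hM : ∀ a b, HasDegree (M a b) (deg' b - deg a))
    (v : Fin q → MvPolynomial σ K) (hv : v ∈ LinearMap.ker M.mulVecLin) (k : ℤ) :
    vecComponent deg' k v ∈ LinearMap.ker M.mulVecLin := by
  classical
  rw [LinearMap.mem_ker, Matrix.mulVecLin_apply] at hv ⊢
  funext a
  ext m
  have key : ∀ b, coeff m (M a b * vecComponent deg' k v b) =
      if (m.degree : ℤ) + deg a = k then coeff m (M a b * v b) else 0 := by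
    intro b
    have hterm : ∀ x ∈ Finset.HasAntidiagonal.antidiagonal m,
        coeff x.1 (M a b) * coeff x.2 (vecComponent deg' k v b) =
          if (m.degree : ℤ) + deg a = k then coeff x.1 (M a b) * coeff x.2 (v b) else 0 := by
      intro x hx
      rw [coeff_vecComponent]
      by_cases h0 : coeff x.1 (M a b) = 0
      · simp [h0]
      · have h1 := hM a b x.1 (mem_support_iff.2 h0)
        have h2 : m.degree = x.1.degree + x.2.degree := by
          rw [← Finset.HasAntidiagonal.mem_antidiagonal.1 hx, map_add]
        have h3 : ((x.2.degree : ℤ) + deg' b = k) ↔ ((m.degree : ℤ) + deg a = k) := by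
          rw [h2]
          push_cast
          omega
        simp only [h3]
        split_ifs <;> simp
    rw [coeff_mul, Finset.sum_congr rfl hterm, coeff_mul]
    split_ifs <;> simp
  have hva : coeff m (∑ b, M a b * v b) = 0 := by
    have := congrFun hv a
    simp only [Matrix.mulVec, dotProduct, Pi.zero_apply] at this
    rw [this, coeff_zero]
  rw [coeff_sum] at hva
  simp only [Matrix.mulVec, dotProduct, Pi.zero_apply, coeff_zero]
  rw [coeff_sum, Finset.sum_congr rfl fun b _ => key b]
  split_ifs
  · exact hva
  · simp

/-- A degree-preserving map between graded free modules of finite rank. -/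
structure HomogeneousMatrix (σ K : Type*) [Field K] where
  p : ℕ
  q : ℕ
  degP : Fin p → ℤ
  degQ : Fin q → ℤ
  M : Matrix (Fin p) (Fin q) (MvPolynomial σ K)
  hasDegree : ∀ a b, HasDegree (M a b) (degQ b - degP a)

lemma HomogeneousMatrix.exists_syzygies [Finite σ] (A : HomogeneousMatrix σ K) :
    ∃ (r : ℕ) (deg' : Fin r → ℤ) (M : Matrix (Fin A.q) (Fin r) (MvPolynomial σ K)),
      (∀ a b, HasDegree (M a b) (deg' b - A.degQ a)) ∧
        LinearMap.range M.mulVecLin = LinearMap.ker A.M.mulVecLin :=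
  exists_homogeneous_cover A.degQ _ fun v hv k => vecComponent_mem_ker A.hasDegree v hv k

/-- A degree-preserving map onto the kernel of a given one. -/
noncomputable def HomogeneousMatrix.next [Finite σ] (A : HomogeneousMatrix σ K) :
    HomogeneousMatrix σ K where
  p := A.q
  q := A.exists_syzygies.choose
  degP := A.degQ
  degQ := A.exists_syzygies.choose_spec.choose
  M := A.exists_syzygies.choose_spec.choose_spec.choose
  hasDegree := A.exists_syzygies.choose_spec.choose_spec.choose_spec.1

lemma HomogeneousMatrix.exact_next [Finite σ] (A : HomogeneousMatrix σ K) :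
    Function.Exact A.next.M.mulVec A.M.mulVec := by
  have h := A.exists_syzygies.choose_spec.choose_spec.choose_spec.2
  exact fun v => (SetLike.ext_iff.1 h v).symm

/-- Iterated syzygies. -/
noncomputable def HomogeneousMatrix.seq [Finite σ] (A : HomogeneousMatrix σ K) :
    ℕ → HomogeneousMatrix σ K
  | 0 => A.next
  | n + 1 => (A.seq n).next

/-- Every homogeneous ideal of a polynomial ring in finitely many variables has a graded free
resolution. -/
theorem nonempty_gradedFreeResolution [Finite σ]
    (I : HomogeneousIdeal (homogeneousSubmodule σ K)) :
    Nonempty (GradedFreeResolution I.toIdeal) := by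
  let N : Submodule (MvPolynomial σ K) (Fin 1 → MvPolynomial σ K) :=
    Submodule.comap (LinearMap.proj (0 : Fin 1)) I.toIdeal
  have hN : ∀ v ∈ N, ∀ k, vecComponent (fun _ => 0) k v ∈ N := by
    intro v hv k
    change vecComponent (fun _ => 0) k v 0 ∈ I.toIdeal
    unfold vecComponent
    split_ifs
    · exact homogeneousComponent_mem_of_mem I.isHomogeneous hv _
    · exact I.toIdeal.zero_mem
  obtain ⟨r, deg', M, hM, hr⟩ := exists_homogeneous_cover (fun _ : Fin 1 => (0 : ℤ)) N hN
  let A : HomogeneousMatrix σ K := ⟨1, r, fun _ => 0, deg', M, hM⟩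
  have hA : Function.Exact (A.seq 0).M.mulVec A.M.mulVec := A.exact_next
  refine ⟨{
    rank := fun n => (A.seq n).p
    deg := fun n => (A.seq n).degP
    gen := fun a => M 0 a
    d := fun n => (A.seq n).M
    gen_hasDegree := fun a => by
      have := hM 0 a
      rwa [sub_zero] at this
    d_hasDegree := fun n => (A.seq n).hasDegree
    span_gen := ?_
    exact_gen := ?_
    exact_d := fun n => (A.seq n).exact_next }⟩
  · ext f
    have h := SetLike.ext_iff.1 hr (fun _ => f)
    have h1 : (fun _ => f) ∈ N ↔ f ∈ I.toIdeal := Iff.rfl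
    rw [← h1, ← h, Ideal.span, Submodule.mem_span_range_iff_exists_fun]
    simp only [LinearMap.mem_range, Matrix.mulVecLin_apply]
    refine exists_congr fun c => ?_
    constructor
    · intro hc
      funext a
      rw [Subsingleton.elim a 0, ← hc]
      simp only [Matrix.mulVec, dotProduct, smul_eq_mul]
      exact Finset.sum_congr rfl fun b _ => mul_comm _ _
    · intro hc
      rw [← congrFun hc 0]
      simp only [Matrix.mulVec, dotProduct, smul_eq_mul]
      exact Finset.sum_congr rfl fun b _ => mul_comm _ _
  · intro v
    refine Iff.trans ⟨fun hv => ?_, fun hv => congrFun hv 0⟩ (hA v)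
    funext a
    obtain rfl := Subsingleton.elim a 0
    exact hv

end Existence

/-- The graded Betti number `β_{i,j}(I) = dim_K Tor_i^S(I, K)_j` of a homogeneous ideal `I` of
`S = MvPolynomial σ K`, computed from a graded free resolution of `I`. -/
noncomputable def gradedBetti {σ K : Type*} [Field K] [Finite σ]
    (I : HomogeneousIdeal (homogeneousSubmodule σ K)) (i : ℕ) (j : ℤ) : ℕ :=
  Module.finrank K ((nonempty_gradedFreeResolution I).some.Tor i j)

/-- `I` has a `d`-linear resolution: the only nonzero Betti numbers are the `β_{i,i+d}(I)`. -/
def HasLinearResolution {σ K : Type*} [Field K] [Finite σ]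
    (I : HomogeneousIdeal (homogeneousSubmodule σ K)) (d : ℤ) : Prop :=
  ∀ (i : ℕ) (j : ℤ), j ≠ i + d → gradedBetti I i j = 0

/-! ## The ideals of the statement

In `MvPolynomial (Fin h ⊕ Fin h) K` the variables indexed by the left summand are
`y_1, …, y_h` (or `u_1, …, u_h`), those indexed by the right summand are `z_1, …, z_h`
(or `v_1, …, v_h`). -/

/-- The `ℝ`-algebra map `ℝ[y_j, z_j] → ℂ[x_1, …, x_h]` with `y_j ↦ x_j` and `z_j ↦ i x_j`; its
image is the subring `ℝ[x_j, i x_j]`. -/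
noncomputable def presentationMap (h : ℕ) :
    MvPolynomial (Fin h ⊕ Fin h) ℝ →ₐ[ℝ] MvPolynomial (Fin h) ℂ :=
  aeval (Sum.elim (fun j => X j) (fun j => C Complex.I * X j))

/-- The homogeneous ideal `(u_1, …, u_h)(v_1, …, v_h)` of `K[u_1, …, u_h, v_1, …, v_h]`. -/
noncomputable def gammaIdeal (K : Type*) [Field K] (h : ℕ) :
    HomogeneousIdeal (homogeneousSubmodule (Fin h ⊕ Fin h) K) where
  toSubmodule := Ideal.span (Set.range fun j : Fin h => X (Sum.inl j)) *
    Ideal.span (Set.range fun j : Fin h => X (Sum.inr j))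
  is_homogeneous' := by
    apply Ideal.IsHomogeneous.mul <;>
    · apply Ideal.homogeneous_span
      rintro _ ⟨j, rfl⟩
      exact ⟨1, isHomogeneous_X _ _⟩

/-!
The Betti numbers are computed from an explicit minimal resolution of `Γ = 𝔲 𝔳`, where `𝔲` and `𝔳`
are generated by the variables `u_j` and `v_j`, and are carried over to `𝔭(h)` by complexification.

*Independence of the resolution.* `gradedBetti` refers to an arbitrary graded free resolution `E`.
If `G` is another graded free resolution of the same ideal, then the identity lifts to
degree-preserving chain maps between `E` and `G` that are inverse up to homotopy. If moreover all
entries of the matrices of `G` have constant term zero, then `E ⊗ K` has in each degree the same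
homology as `G ⊗ K`, whose differentials vanish. So the Betti numbers count the basis elements of
`G` (`CyclicResolution.card_strand_eq`, `GradedFreeResolution.finrank_tor_add`).

*The resolution of `Γ`.* The quotient of the Koszul complex of all variables by the Koszul complexes
of the `u_j` and of the `v_j` has a basis indexed by the mixed sets of variables, which contain some
`u_j` and some `v_k`. It is exact at the mixed sets with more than two elements because the three
Koszul complexes are exact in positive homological degrees (`koszul_exact`, `koszul_mixed_exact`),
and its cokernel at the mixed pairs is `Γ`. Its differentials are linear, so it is minimal. There are
`(2h choose n) - 2 (h choose n)` mixed sets with `n > 0` elements (`mixedResolution`,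
`card_isCell_add`).

*From `Γ` to `𝔭(h)`.* The composite `φ` of the inclusion `ℝ[y, z] ⊆ ℂ[y, z]` with the change of
coordinates `u = y + i z`, `v = y - i z` exhibits `ℂ[u, v]` as a free `ℝ[y, z]`-module with basis
`1, i`. Hence `φ` preserves exactness and the ranks of the matrices of constant terms. The ideal
`𝔭(h)` is the contraction of `𝔲`, and also of `𝔳` by complex conjugation; since `𝔲 ∩ 𝔳 = 𝔲 𝔳`, its
extension is `Γ` (`map_ker_presentationMap`).

*The height.* Contracting the primes generated by the initial segments of `u_1, …, u_h, v_1, …, v_h`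
gives a strict chain of `2h + 1` primes of `ℝ[y, z]` with `𝔭(h)` in the middle; as this ring has
dimension `2h`, the height of `𝔭(h)` is `h` (`height_ker_presentationMap`).
-/

/-! ### Degrees of polynomials and graded matrices -/

section Degrees

variable {σ K : Type*} [Field K]

namespace HasDegree

lemma coeff_eq_zero {f : MvPolynomial σ K} {k : ℤ} (hf : HasDegree f k) {m : σ →₀ ℕ}
    (hm : (m.degree : ℤ) ≠ k) : coeff m f = 0 := by
  by_contra h
  exact hm (hf m (mem_support_iff.2 h))

lemma of_coeff {f : MvPolynomial σ K} {k : ℤ}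
    (hf : ∀ m : σ →₀ ℕ, (m.degree : ℤ) ≠ k → coeff m f = 0) : HasDegree f k := fun m hm => by
  by_contra h
  exact mem_support_iff.1 hm (hf m h)

lemma zero (k : ℤ) : HasDegree (0 : MvPolynomial σ K) k := of_coeff fun m _ => coeff_zero m

lemma one : HasDegree (1 : MvPolynomial σ K) 0 := of_coeff fun m hm => by
  classical
  rw [coeff_one, if_neg]
  rintro rfl
  simp at hm

lemma sub {f g : MvPolynomial σ K} {k : ℤ} (hf : HasDegree f k) (hg : HasDegree g k) :
    HasDegree (f - g) k := of_coeff fun m hm => by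
  rw [coeff_sub, hf.coeff_eq_zero hm, hg.coeff_eq_zero hm, sub_zero]

lemma sum {ι : Type*} {s : Finset ι} {f : ι → MvPolynomial σ K} {k : ℤ}
    (hf : ∀ i ∈ s, HasDegree (f i) k) : HasDegree (∑ i ∈ s, f i) k := of_coeff fun m hm => by
  rw [coeff_sum]
  exact Finset.sum_eq_zero fun i hi => (hf i hi).coeff_eq_zero hm

lemma mul {f g : MvPolynomial σ K} {k l : ℤ} (hf : HasDegree f k) (hg : HasDegree g l) :
    HasDegree (f * g) (k + l) := of_coeff fun m hm => by
  classical
  rw [coeff_mul]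
  refine Finset.sum_eq_zero fun x hx => ?_
  have hx' : x.1.degree + x.2.degree = m.degree := by
    rw [← map_add, Finset.HasAntidiagonal.mem_antidiagonal.1 hx]
  by_cases h1 : (x.1.degree : ℤ) = k
  · rw [hg.coeff_eq_zero (by omega), mul_zero]
  · rw [hf.coeff_eq_zero h1, zero_mul]

lemma of_isHomogeneous {f : MvPolynomial σ K} {n : ℕ} (hf : f.IsHomogeneous n) :
    HasDegree f n := of_coeff fun m hm => hf.coeff_eq_zero (by exact_mod_cast hm)

lemma constantCoeff_eq_zero {f : MvPolynomial σ K} {k : ℤ} (hf : HasDegree f k) (hk : k ≠ 0) :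
    constantCoeff f = 0 := by
  rw [constantCoeff_eq]
  exact hf.coeff_eq_zero (by simpa using hk.symm)

end HasDegree

/-- The homogeneous component of `f` of degree `k`, for an integer `k`; it is zero for `k < 0`. -/
noncomputable def degreePart (k : ℤ) (f : MvPolynomial σ K) : MvPolynomial σ K :=
  if 0 ≤ k then homogeneousComponent k.toNat f else 0

lemma coeff_degreePart (k : ℤ) (f : MvPolynomial σ K) (m : σ →₀ ℕ) :
    coeff m (degreePart k f) = if (m.degree : ℤ) = k then coeff m f else 0 := by
  unfold degreePart
  split_ifs with h1 h2 h2
  · rw [coeff_homogeneousComponent, if_pos (by omega)]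
  · rw [coeff_homogeneousComponent, if_neg (by omega)]
  · omega
  · simp

lemma hasDegree_degreePart (k : ℤ) (f : MvPolynomial σ K) : HasDegree (degreePart k f) k :=
  .of_coeff fun m hm => by rw [coeff_degreePart, if_neg hm]

lemma HasDegree.degreePart_eq {f : MvPolynomial σ K} {k : ℤ} (hf : HasDegree f k) :
    degreePart k f = f := by
  ext m
  rw [coeff_degreePart]
  split_ifs with h
  · rfl
  · rw [hf.coeff_eq_zero h]

lemma degreePart_sum {ι : Type*} (s : Finset ι) (f : ι → MvPolynomial σ K) (k : ℤ) :
    degreePart k (∑ i ∈ s, f i) = ∑ i ∈ s, degreePart k (f i) := by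
  ext m
  rw [coeff_degreePart, coeff_sum, coeff_sum]
  simp only [coeff_degreePart]
  split_ifs <;> simp

lemma HasDegree.degreePart_mul {f : MvPolynomial σ K} {i : ℤ} (hf : HasDegree f i)
    (k : ℤ) (g : MvPolynomial σ K) : degreePart k (f * g) = f * degreePart (k - i) g := by
  classical
  ext m
  have hdeg : ∀ x ∈ Finset.HasAntidiagonal.antidiagonal m, x.1.degree + x.2.degree = m.degree :=
    fun x hx => by rw [← map_add, Finset.HasAntidiagonal.mem_antidiagonal.1 hx]
  rw [coeff_degreePart, coeff_mul, coeff_mul]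
  split_ifs with hk
  · refine Finset.sum_congr rfl fun x hx => ?_
    have := hdeg x hx
    by_cases h1 : (x.1.degree : ℤ) = i
    · rw [coeff_degreePart, if_pos (by omega)]
    · rw [hf.coeff_eq_zero h1, zero_mul, zero_mul]
  · refine (Finset.sum_eq_zero fun x hx => ?_).symm
    have := hdeg x hx
    by_cases h1 : (x.1.degree : ℤ) = i
    · rw [coeff_degreePart, if_neg (by omega), mul_zero]
    · rw [hf.coeff_eq_zero h1, zero_mul]

/-- A matrix whose columns and rows are labelled by integers is graded if it describes a
degree-preserving map between the graded free modules with generators in these degrees. -/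
def Matrix.IsGraded {α β : Type*} (dα : α → ℤ) (dβ : β → ℤ)
    (M : Matrix α β (MvPolynomial σ K)) : Prop :=
  ∀ a b, HasDegree (M a b) (dβ b - dα a)

namespace Matrix.IsGraded

open Matrix

variable {α β γ : Type*} {dα : α → ℤ} {dβ : β → ℤ} {dγ : γ → ℤ}

lemma sub {M N : Matrix α β (MvPolynomial σ K)} (hM : M.IsGraded dα dβ) (hN : N.IsGraded dα dβ) :
    (M - N).IsGraded dα dβ := fun a b => (hM a b).sub (hN a b)

lemma mul [Fintype β] {M : Matrix α β (MvPolynomial σ K)} {N : Matrix β γ (MvPolynomial σ K)}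
    (hM : M.IsGraded dα dβ) (hN : N.IsGraded dβ dγ) : (M * N).IsGraded dα dγ := fun a c =>
  HasDegree.sum fun b _ => by
    have := (hM a b).mul (hN b c)
    rwa [show dβ b - dα a + (dγ c - dβ b) = dγ c - dα a by ring] at this

lemma one [DecidableEq α] : (1 : Matrix α α (MvPolynomial σ K)).IsGraded dα dα := fun a b => by
  rw [Matrix.one_apply]
  split_ifs with h
  · subst h
    rw [sub_self]
    exact HasDegree.one
  · exact HasDegree.zero _

/-- A degree-preserving map into a graded free module whose image lies in the image of another one
factors through it in a degree-preserving way. -/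
lemma exists_factor [Fintype β] {M : Matrix α β (MvPolynomial σ K)}
    {N : Matrix α γ (MvPolynomial σ K)} (hM : M.IsGraded dα dβ) (hN : N.IsGraded dα dγ)
    (h : ∀ c, ∃ w, M *ᵥ w = N.col c) :
    ∃ L : Matrix β γ (MvPolynomial σ K), L.IsGraded dβ dγ ∧ M * L = N := by
  choose w hw using h
  refine ⟨Matrix.of fun b c => degreePart (dγ c - dβ b) (w c b),
    fun b c => hasDegree_degreePart _ _, ?_⟩
  ext1 a c
  have h1 : ∑ b, M a b * w c b = N a c := congrFun (hw c) a
  rw [← (hN a c).degreePart_eq, ← h1, degreePart_sum, Matrix.mul_apply]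
  refine Finset.sum_congr rfl fun b _ => ?_
  rw [(hM a b).degreePart_mul, Matrix.of_apply]
  congr 2
  ring

end Matrix.IsGraded

/-- The block of degree `j` of the matrix of constant terms of `M`, which describes the degree `j`
part of the map induced by `M` after tensoring with `K = S / (variables)`. -/
noncomputable def Matrix.strand {α β : Type*} (M : Matrix α β (MvPolynomial σ K)) (dα : α → ℤ)
    (dβ : β → ℤ) (j : ℤ) : Matrix {a // dα a = j} {b // dβ b = j} K :=
  (M.map constantCoeff).submatrix Subtype.val Subtype.val

namespace Matrix

variable {α β γ : Type*} {dα : α → ℤ} {dβ : β → ℤ} {dγ : γ → ℤ}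

lemma strand_mul {j : ℤ} [Fintype β] [Fintype {b // dβ b = j}] {M : Matrix α β (MvPolynomial σ K)}
    {N : Matrix β γ (MvPolynomial σ K)} (hN : N.IsGraded dβ dγ) :
    (M * N).strand dα dγ j = M.strand dα dβ j * N.strand dβ dγ j := by
  classical
  ext a c
  simp only [strand, submatrix_apply, map_apply, mul_apply, map_sum, map_mul]
  rw [← Finset.sum_subtype (Finset.univ.filter fun b => dβ b = j) (by simp)
    (fun b => constantCoeff (M a.1 b) * constantCoeff (N b c.1)), Finset.sum_filter]
  refine Finset.sum_congr rfl fun b _ => ?_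
  split_ifs with hb
  · rfl
  · rw [(hN b c.1).constantCoeff_eq_zero, mul_zero]
    have := c.2
    omega

lemma strand_sub (M N : Matrix α β (MvPolynomial σ K)) (j : ℤ) :
    (M - N).strand dα dβ j = M.strand dα dβ j - N.strand dα dβ j := by
  ext a b
  simp [strand]

lemma strand_add (M N : Matrix α β (MvPolynomial σ K)) (j : ℤ) :
    (M + N).strand dα dβ j = M.strand dα dβ j + N.strand dα dβ j := by
  ext a b
  simp [strand]

lemma strand_zero (j : ℤ) :
    (0 : Matrix α β (MvPolynomial σ K)).strand dα dβ j = 0 := by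
  ext a b
  simp [strand]

lemma strand_one [DecidableEq α] (j : ℤ) :
    (1 : Matrix α α (MvPolynomial σ K)).strand dα dα j = 1 := by
  ext a b
  simp only [strand, submatrix_apply, map_apply, one_apply, Subtype.ext_iff]
  split_ifs <;> simp

end Matrix

end Degrees

/-! ### Comparison of graded free resolutions -/

open Matrix in
/-- Rank count for a complex `γ → β → α` of finite-dimensional vector spaces that is homotopy
equivalent to a complex with zero differentials: the homology at `β` has dimension `card δ`. -/
lemma Matrix.card_eq_rank_add_rank_add_card {K α β γ δ : Type*} [Field K] [Fintype α] [Fintype β]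
    [Fintype γ] [Fintype δ] [DecidableEq β] [DecidableEq δ] (A : Matrix α β K) (B : Matrix β γ K)
    (f : Matrix δ β K) (g : Matrix β δ K) (s : Matrix γ β K) (t : Matrix β α K) (hAB : A * B = 0)
    (hfg : f * g = 1) (hgf : 1 - g * f = B * s + t * A) (hfB : f * B = 0) (hAg : A * g = 0) :
    Fintype.card β = A.rank + B.rank + Fintype.card δ := by
  have hinj : LinearMap.ker g.mulVecLin = ⊥ := by
    rw [LinearMap.ker_eq_bot']
    intro x hx
    rw [Matrix.mulVecLin_apply] at hx
    rw [← Matrix.one_mulVec x, ← hfg, ← Matrix.mulVec_mulVec, hx, Matrix.mulVec_zero]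
  have hker : LinearMap.ker A.mulVecLin =
      LinearMap.range B.mulVecLin ⊔ LinearMap.range g.mulVecLin := by
    apply le_antisymm
    · intro x hx
      rw [LinearMap.mem_ker, Matrix.mulVecLin_apply] at hx
      have h1 : x - g *ᵥ f *ᵥ x = B *ᵥ s *ᵥ x := by
        have := congrArg (· *ᵥ x) hgf
        simp only [Matrix.sub_mulVec, Matrix.one_mulVec, Matrix.add_mulVec,
          ← Matrix.mulVec_mulVec, hx, Matrix.mulVec_zero, add_zero] at this
        exact this
      rw [← sub_add_cancel x (g *ᵥ f *ᵥ x), h1]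
      exact Submodule.add_mem_sup ⟨_, rfl⟩ ⟨_, rfl⟩
    · refine sup_le ?_ ?_ <;> rintro _ ⟨x, rfl⟩ <;>
        simp [Matrix.mulVec_mulVec, hAB, hAg]
  have hdisj : LinearMap.range B.mulVecLin ⊓ LinearMap.range g.mulVecLin = ⊥ := by
    rw [eq_bot_iff]
    rintro _ ⟨⟨x, rfl⟩, ⟨y, hy⟩⟩
    rw [Matrix.mulVecLin_apply, Matrix.mulVecLin_apply] at hy
    have hy0 : y = 0 := by
      rw [← Matrix.one_mulVec y, ← hfg, ← Matrix.mulVec_mulVec, hy, Matrix.mulVec_mulVec, hfB,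
        Matrix.zero_mulVec]
    rw [Matrix.mulVecLin_apply, ← hy, hy0, Matrix.mulVec_zero]
    exact Submodule.zero_mem _
  have h1 := LinearMap.finrank_range_add_finrank_ker A.mulVecLin
  have h2 := Submodule.finrank_sup_add_finrank_inf_eq (LinearMap.range B.mulVecLin)
    (LinearMap.range g.mulVecLin)
  rw [hdisj, finrank_bot, add_zero, ← hker, LinearMap.finrank_range_of_inj
    (LinearMap.ker_eq_bot.1 hinj), Module.finrank_fintype_fun_eq_card] at h2
  rw [Module.finrank_fintype_fun_eq_card] at h1
  rw [Matrix.rank, Matrix.rank, add_assoc, ← h2, h1]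

/-- A graded free resolution `⋯ → F_2 → F_1 → S` of a cyclic module `S / I`, where
`S = MvPolynomial σ K`: the module in homological degree `n` has a basis indexed by `ι n` with
degrees `deg n`, and the module in homological degree `0` is `S` itself. Regarding a resolution of
the ideal `I` as a resolution of `S / I` turns the augmentation `F_1 → I ⊆ S` into one of the
differentials. -/
structure CyclicResolution (σ K : Type*) [Field K] where
  ι : ℕ → Type
  fintype : ∀ n, Fintype (ι n)
  decEq : ∀ n, DecidableEq (ι n)
  unique : Unique (ι 0)
  deg : ∀ n, ι n → ℤ
  deg_zero : ∀ a, deg 0 a = 0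
  d : ∀ n, Matrix (ι n) (ι (n + 1)) (MvPolynomial σ K)
  isGraded : ∀ n, (d n).IsGraded (deg n) (deg (n + 1))
  exact : ∀ n, Function.Exact (d (n + 1)).mulVec (d n).mulVec

namespace CyclicResolution

variable {σ K : Type*} [Field K] (C E G : CyclicResolution σ K)

open Matrix

attribute [instance] fintype decEq unique

lemma d_mul_d (n : ℕ) : C.d n * C.d (n + 1) = 0 := by
  refine Matrix.ext_of_mulVec_single fun i => ?_
  rw [← Matrix.mulVec_mulVec, (C.exact n).apply_apply_eq_zero, Matrix.zero_mulVec]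

/-- The ideal `I` such that the complex is a resolution of `S / I`. -/
noncomputable def ideal : Ideal (MvPolynomial σ K) := Ideal.span (Set.range (C.d 0 default))

lemma exists_mulVec_eq_iff (v : C.ι 0 → MvPolynomial σ K) :
    (∃ w, C.d 0 *ᵥ w = v) ↔ v default ∈ C.ideal := by
  rw [ideal, Ideal.span, Submodule.mem_span_range_iff_exists_fun]
  refine exists_congr fun w => ?_
  rw [funext_iff, Unique.forall_iff]
  simp only [Matrix.mulVec, dotProduct, smul_eq_mul, mul_comm]

variable {C E}

/-- Degree-preserving chain maps between resolutions of `S / I` and `S / J`, for `I ≤ J`, that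
extend the identity of `S`. -/
lemma exists_chainMap (h : C.ideal ≤ E.ideal) :
    ∃ f : ∀ n, Matrix (E.ι n) (C.ι n) (MvPolynomial σ K),
      (∀ n, (f n).IsGraded (E.deg n) (C.deg n)) ∧ (f 0 = Matrix.of fun _ _ => 1) ∧
        ∀ n, f n * C.d n = E.d n * f (n + 1) := by
  let α : ℕ → Type _ := fun n => {f : Matrix (E.ι n) (C.ι n) (MvPolynomial σ K) //
    f.IsGraded (E.deg n) (C.deg n) ∧ ∀ w, ∃ w', E.d n *ᵥ w' = (f * C.d n) *ᵥ w}
  have step : ∀ n (f : α n), ∃ g : α (n + 1), f.1 * C.d n = E.d n * g.1 := by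
    rintro n ⟨f, hf, hf'⟩
    obtain ⟨L, hL, hL'⟩ := (E.isGraded n).exists_factor (hf.mul (C.isGraded n)) fun c => by
      obtain ⟨w, hw⟩ := hf' (Pi.single c 1)
      exact ⟨w, by rw [hw, Matrix.mulVec_single_one]⟩
    refine ⟨⟨L, hL, fun w => (E.exact n _).1 ?_⟩, hL'.symm⟩
    rw [Matrix.mulVec_mulVec, ← Matrix.mul_assoc, hL', Matrix.mul_assoc, C.d_mul_d,
      Matrix.mul_zero, Matrix.zero_mulVec]
  choose s hs using step
  have h0 : (Matrix.of fun _ _ => 1 : Matrix (E.ι 0) (C.ι 0) (MvPolynomial σ K)).IsGraded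
      (E.deg 0) (C.deg 0) := fun a b => by
    rw [C.deg_zero, E.deg_zero, sub_self]
    exact HasDegree.one
  have h0' : ∀ w, ∃ w', E.d 0 *ᵥ w' =
      ((Matrix.of fun _ _ => 1 : Matrix (E.ι 0) (C.ι 0) (MvPolynomial σ K)) * C.d 0) *ᵥ w := by
    intro w
    rw [E.exists_mulVec_eq_iff, ← Matrix.mulVec_mulVec]
    have := h ((C.exists_mulVec_eq_iff (C.d 0 *ᵥ w)).1 ⟨w, rfl⟩)
    simpa [Matrix.mulVec, dotProduct] using this
  let F : ∀ n, α n := fun n => Nat.rec ⟨_, h0, h0'⟩ s n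
  exact ⟨fun n => (F n).1, fun n => (F n).2.1, rfl, fun n => hs n (F n)⟩

/-- A degree-preserving chain map into a resolution that vanishes in homological degree `0` is
null-homotopic. -/
lemma exists_homotopy (ψ : ∀ n, Matrix (E.ι n) (C.ι n) (MvPolynomial σ K))
    (hψ : ∀ n, (ψ n).IsGraded (E.deg n) (C.deg n)) (hψ0 : ψ 0 = 0)
    (hψd : ∀ n, ψ n * C.d n = E.d n * ψ (n + 1)) :
    ∃ s : ∀ n, Matrix (E.ι (n + 1)) (C.ι n) (MvPolynomial σ K),
      (∀ n, (s n).IsGraded (E.deg (n + 1)) (C.deg n)) ∧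
        ∀ n, ψ (n + 1) = E.d (n + 1) * s (n + 1) + s n * C.d n := by
  let α : ℕ → Type _ := fun n => {s : Matrix (E.ι (n + 1)) (C.ι n) (MvPolynomial σ K) //
    s.IsGraded (E.deg (n + 1)) (C.deg n) ∧ (ψ n - E.d n * s) * C.d n = 0}
  have step : ∀ n (s : α n), ∃ t : α (n + 1),
      ψ (n + 1) = E.d (n + 1) * t.1 + s.1 * C.d n := by
    rintro n ⟨s, hs, hs'⟩
    obtain ⟨L, hL, hL'⟩ := (E.isGraded (n + 1)).exists_factor
      ((hψ (n + 1)).sub (hs.mul (C.isGraded n))) fun c => by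
        refine (E.exact n _).1 ?_
        rw [← Matrix.mulVec_single_one, Matrix.mulVec_mulVec, Matrix.mul_sub, ← hψd,
          ← Matrix.mul_assoc, ← Matrix.sub_mul, hs', Matrix.zero_mulVec]
    refine ⟨⟨L, hL, ?_⟩, ?_⟩
    · rw [hL', sub_sub_cancel, Matrix.mul_assoc, C.d_mul_d, Matrix.mul_zero]
    · rw [hL', sub_add_cancel]
  choose t ht using step
  have h0 : (0 : Matrix (E.ι 1) (C.ι 0) (MvPolynomial σ K)).IsGraded (E.deg 1) (C.deg 0) :=
    fun _ _ => HasDegree.zero _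
  let F : ∀ n, α n := fun n => Nat.rec ⟨0, h0, by simp [hψ0]⟩ t n
  exact ⟨fun n => (F n).1, fun n => (F n).2.1, fun n => ht n (F n)⟩

variable (C) in
/-- The degree `j` part of the differential of the complex tensored with `K`. -/
noncomputable abbrev strandD (n : ℕ) (j : ℤ) :
    Matrix {a // C.deg n a = j} {a // C.deg (n + 1) a = j} K :=
  (C.d n).strand (C.deg n) (C.deg (n + 1)) j

/-- If a minimal graded free resolution `G` of `S / I` is known, then the homology of `E ⊗ K` for an
arbitrary graded free resolution `E` of `S / I` has the dimension of `G ⊗ K`, because `E` and `G`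
are homotopy equivalent and the differentials of `G ⊗ K` vanish. -/
theorem card_strand_eq (hEG : E.ideal = G.ideal)
    (hG : ∀ n a b, constantCoeff (G.d n a b) = 0) (n : ℕ) (j : ℤ) :
    Fintype.card {a // E.deg (n + 1) a = j} = (E.strandD n j).rank + (E.strandD (n + 1) j).rank +
      Fintype.card {c // G.deg (n + 1) c = j} := by
  obtain ⟨f, hf, hf0, hfd⟩ := exists_chainMap hEG.le
  obtain ⟨g, hg, hg0, hgd⟩ := exists_chainMap hEG.ge
  have hone : ∀ C' E' : CyclicResolution σ K,
      (Matrix.of fun _ _ => 1 : Matrix (C'.ι 0) (E'.ι 0) (MvPolynomial σ K)) *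
        (Matrix.of fun _ _ => 1 : Matrix (E'.ι 0) (C'.ι 0) (MvPolynomial σ K)) = 1 := by
    intro C' E'
    ext1 a b
    obtain rfl := Subsingleton.elim a b
    simp [Matrix.mul_apply]
  obtain ⟨s, hs, hsd⟩ := exists_homotopy (C := E) (E := E) (fun n => 1 - g n * f n)
    (fun n => Matrix.IsGraded.one.sub ((hg n).mul (hf n))) (by simp [hf0, hg0, hone])
    fun n => by
      rw [Matrix.sub_mul, Matrix.mul_sub, Matrix.mul_assoc, hfd, ← Matrix.mul_assoc, hgd,
        Matrix.mul_assoc, Matrix.one_mul, Matrix.mul_one]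
  obtain ⟨t, ht, htd⟩ := exists_homotopy (C := G) (E := G) (fun n => 1 - f n * g n)
    (fun n => Matrix.IsGraded.one.sub ((hf n).mul (hg n))) (by simp [hf0, hg0, hone])
    fun n => by
      rw [Matrix.sub_mul, Matrix.mul_sub, Matrix.mul_assoc, hgd, ← Matrix.mul_assoc, hfd,
        Matrix.mul_assoc, Matrix.one_mul, Matrix.mul_one]
  -- The same identities for the strands in degree `j`.
  have hG0 : ∀ n, (G.d n).strand (G.deg n) (G.deg (n + 1)) j = 0 := fun n => by
    ext a b
    simp [Matrix.strand, hG]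
  refine Matrix.card_eq_rank_add_rank_add_card _ _
    ((f (n + 1)).strand (G.deg (n + 1)) (E.deg (n + 1)) j)
    ((g (n + 1)).strand (E.deg (n + 1)) (G.deg (n + 1)) j)
    ((s (n + 1)).strand (E.deg (n + 2)) (E.deg (n + 1)) j)
    ((s n).strand (E.deg (n + 1)) (E.deg n) j) ?_ ?_ ?_ ?_ ?_
  · rw [← Matrix.strand_mul (E.isGraded _), E.d_mul_d, Matrix.strand_zero]
  · have := congrArg (fun M => Matrix.strand M (G.deg (n + 1)) (G.deg (n + 1)) j) (htd n)
    simp only [Matrix.strand_sub, Matrix.strand_add, Matrix.strand_one,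
      Matrix.strand_mul (hg _), Matrix.strand_mul (ht _), Matrix.strand_mul (G.isGraded _)] at this
    rw [hG0, hG0, Matrix.zero_mul, Matrix.mul_zero, add_zero, sub_eq_zero] at this
    exact this.symm
  · have := congrArg (fun M => Matrix.strand M (E.deg (n + 1)) (E.deg (n + 1)) j) (hsd n)
    simpa only [Matrix.strand_sub, Matrix.strand_add, Matrix.strand_one,
      Matrix.strand_mul (hf _), Matrix.strand_mul (hs _), Matrix.strand_mul (E.isGraded _)] using this
  · rw [← Matrix.strand_mul (E.isGraded _), hfd, Matrix.strand_mul (hf _), hG0, Matrix.zero_mul]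
  · rw [← Matrix.strand_mul (hg _), ← hgd, Matrix.strand_mul (G.isGraded _), hG0, Matrix.mul_zero]

end CyclicResolution

/-! ### Betti numbers as coranks -/

namespace GradedFreeResolution

open Matrix

variable {σ K : Type*} [Field K] {I : Ideal (MvPolynomial σ K)} (F : GradedFreeResolution I)

/-- A graded free resolution of `I`, regarded as a resolution of `S / I`. -/
noncomputable def toCyclic : CyclicResolution σ K where
  ι
    | 0 => Unit
    | n + 1 => Fin (F.rank n)
  fintype
    | 0 => inferInstanceAs (Fintype Unit)
    | n + 1 => inferInstanceAs (Fintype (Fin (F.rank n)))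
  decEq
    | 0 => inferInstanceAs (DecidableEq Unit)
    | n + 1 => inferInstanceAs (DecidableEq (Fin (F.rank n)))
  unique := inferInstanceAs (Unique Unit)
  deg
    | 0 => fun _ => 0
    | n + 1 => F.deg n
  deg_zero _ := rfl
  d
    | 0 => Matrix.of fun _ a => F.gen a
    | n + 1 => F.d n
  isGraded
    | 0 => fun _ b => by
      have := F.gen_hasDegree b
      rwa [← sub_zero (F.deg 0 b)] at this
    | n + 1 => F.d_hasDegree n
  exact
    | 0 => fun v => by
      rw [← F.exact_gen v, funext_iff]
      exact ⟨fun h => h (), fun h _ => h⟩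
    | n + 1 => F.exact_d n

lemma ideal_toCyclic : F.toCyclic.ideal = I := F.span_gen

lemma boundaries_le_cycles (i : ℕ) (j : ℤ) : F.boundaries i j ≤ F.cycles i j := by
  cases i with
  | zero => exact le_top
  | succ n =>
    rintro _ ⟨x, rfl⟩
    have h1 := Matrix.strand_mul (M := F.d n) (N := F.d (n + 1)) (dα := F.deg n) (j := j)
      (F.d_hasDegree (n + 1))
    have h2 : F.d n * F.d (n + 1) = 0 := F.toCyclic.d_mul_d (n + 1)
    rw [h2, Matrix.strand_zero] at h1
    change (F.d n).strand (F.deg n) (F.deg (n + 1)) j *ᵥ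
      ((F.d (n + 1)).strand (F.deg (n + 1)) (F.deg (n + 2)) j *ᵥ x) = 0
    rw [Matrix.mulVec_mulVec, ← h1, Matrix.zero_mulVec]

/-- The graded Betti numbers in terms of the ranks of the strands of the resolution of `S / I`. -/
lemma finrank_tor_add (hI : ∀ a, constantCoeff (F.gen a) = 0) (i : ℕ) (j : ℤ) :
    Module.finrank K (F.Tor i j) + (F.toCyclic.strandD i j).rank +
      (F.toCyclic.strandD (i + 1) j).rank =
        Fintype.card {a // F.toCyclic.deg (i + 1) a = j} := by
  have h1 : Module.finrank K (F.Tor i j) + Module.finrank K (F.boundaries i j) =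
      Module.finrank K (F.cycles i j) := by
    rw [← (Submodule.submoduleOfEquivOfLe (F.boundaries_le_cycles i j)).finrank_eq]
    exact Submodule.finrank_quotient_add_finrank _
  have h2 : Module.finrank K (F.boundaries i j) = (F.toCyclic.strandD (i + 1) j).rank := rfl
  have h3 : Module.finrank K (F.cycles i j) + (F.toCyclic.strandD i j).rank =
      Fintype.card {a // F.toCyclic.deg (i + 1) a = j} := by
    rw [add_comm, ← Module.finrank_fintype_fun_eq_card K,
      ← LinearMap.finrank_range_add_finrank_ker (F.toCyclic.strandD i j).mulVecLin]
    congr 1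
    cases i with
    | zero =>
      have : F.toCyclic.strandD 0 j = 0 := by
        ext a b
        exact hI b.1
      rw [this, Matrix.mulVecLin_zero, LinearMap.ker_zero]
      rfl
    | succ n => rfl
  omega

end GradedFreeResolution

/-! ### Extension of scalars from the real to the complex numbers -/

section ScalarExtension

open Matrix

/-- The rank of a real matrix does not change over the complex numbers. -/
lemma Matrix.rank_map_ofReal {m n : Type*} [Fintype m] [Fintype n] (A : Matrix m n ℝ) :
    (A.map (algebraMap ℝ ℂ)).rank = A.rank := by
  -- The complex kernel is the sum of the real kernel and `I` times the real kernel.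
  let ψ : (LinearMap.ker A.mulVecLin × LinearMap.ker A.mulVecLin) →ₗ[ℝ]
      LinearMap.ker (A.map (algebraMap ℝ ℂ)).mulVecLin :=
    { toFun := fun x => ⟨fun i => ⟨x.1.1 i, x.2.1 i⟩, by
        have h1 := x.1.2
        have h2 := x.2.2
        rw [LinearMap.mem_ker, mulVecLin_apply] at h1 h2 ⊢
        ext i
        apply Complex.ext
        · simpa [mulVec, dotProduct] using congrFun h1 i
        · simpa [mulVec, dotProduct] using congrFun h2 i⟩
      map_add' := fun x y => by
        ext i
        apply Complex.ext <;> simp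
      map_smul' := fun c x => by
        ext i
        apply Complex.ext <;> simp }
  have hψ : Function.Bijective ψ := by
    constructor
    · intro x y hxy
      have h (i : n) := congrFun (congrArg Subtype.val hxy) i
      ext i
      · exact congrArg Complex.re (h i)
      · exact congrArg Complex.im (h i)
    · rintro ⟨v, hv⟩
      rw [LinearMap.mem_ker, mulVecLin_apply] at hv
      refine ⟨(⟨fun i => (v i).re, ?_⟩, ⟨fun i => (v i).im, ?_⟩), rfl⟩ <;>
      · rw [LinearMap.mem_ker, mulVecLin_apply]
        ext i
        have := congrFun hv i
        first
        | simpa [mulVec, dotProduct] using congrArg Complex.re this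
        | simpa [mulVec, dotProduct] using congrArg Complex.im this
  have h1 := (LinearEquiv.ofBijective ψ hψ).finrank_eq
  rw [Module.finrank_prod, ← Module.finrank_mul_finrank ℝ ℂ (LinearMap.ker (A.map (algebraMap ℝ ℂ)).mulVecLin),
    Complex.finrank_real_complex] at h1
  have h2 := LinearMap.finrank_range_add_finrank_ker A.mulVecLin
  have h3 := LinearMap.finrank_range_add_finrank_ker (A.map (algebraMap ℝ ℂ)).mulVecLin
  rw [Module.finrank_fintype_fun_eq_card] at h2 h3
  rw [Matrix.rank, Matrix.rank]
  omega

variable {σ : Type*}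

/-- A ring homomorphism `φ : ℝ[σ] → ℂ[σ]` of degree zero that makes the complex polynomial ring the
complexification of the real one: every complex polynomial is uniquely of the form
`φ a + i φ b`. -/
structure IsComplexification (φ : MvPolynomial σ ℝ →+* MvPolynomial σ ℂ) : Prop where
  hasDegree : ∀ f n, HasDegree f n → HasDegree (φ f) n
  constantCoeff : ∀ f, constantCoeff (φ f) = algebraMap ℝ ℂ (constantCoeff f)
  exists_eq : ∀ f, ∃ a b, f = φ a + C Complex.I * φ b
  eq_zero : ∀ a b, φ a + C Complex.I * φ b = 0 → a = 0 ∧ b = 0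

variable {φ : MvPolynomial σ ℝ →+* MvPolynomial σ ℂ} 

lemma map_mulVec_add {p q : Type*} [Fintype q] (A : Matrix p q (MvPolynomial σ ℝ))
    (a b : q → MvPolynomial σ ℝ) :
    (A.map φ) *ᵥ (fun i => φ (a i) + C Complex.I * φ (b i)) =
      fun i => φ ((A *ᵥ a) i) + C Complex.I * φ ((A *ᵥ b) i) := by
  ext1 i
  simp only [mulVec, dotProduct, map_apply, map_sum, map_mul, Finset.mul_sum,
    ← Finset.sum_add_distrib]
  exact Finset.sum_congr rfl fun _ _ => by ring

lemma IsComplexification.exact (hφ : IsComplexification φ) {l m n : Type*} [Fintype m] [Fintype n]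
    {M : Matrix l m (MvPolynomial σ ℝ)} {N : Matrix m n (MvPolynomial σ ℝ)}
    (h : Function.Exact N.mulVec M.mulVec) :
    Function.Exact (N.map φ).mulVec (M.map φ).mulVec := by
  intro v
  choose a b hab using fun i => hφ.exists_eq (v i)
  obtain rfl : v = fun i => φ (a i) + C Complex.I * φ (b i) := funext hab
  constructor
  · intro hv
    rw [map_mulVec_add, funext_iff] at hv
    obtain ⟨x, rfl⟩ := (h a).1 (funext fun i => (hφ.eq_zero _ _ (hv i)).1)
    obtain ⟨y, rfl⟩ := (h b).1 (funext fun i => (hφ.eq_zero _ _ (hv i)).2)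
    exact ⟨_, map_mulVec_add N x y⟩
  · rintro ⟨w, hw⟩
    choose x y hxy using fun i => hφ.exists_eq (w i)
    obtain rfl : w = fun i => φ (x i) + C Complex.I * φ (y i) := funext hxy
    rw [map_mulVec_add] at hw
    rw [← hw, map_mulVec_add, h.apply_apply_eq_zero, h.apply_apply_eq_zero]
    ext1 i
    simp

/-- The complexification of a resolution. -/
noncomputable def CyclicResolution.map (C : CyclicResolution σ ℝ)
    (hφ : IsComplexification φ) : CyclicResolution σ ℂ where
  ι := C.ι
  fintype := C.fintype
  decEq := C.decEq
  unique := C.unique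
  deg := C.deg
  deg_zero := C.deg_zero
  d n := (C.d n).map φ
  isGraded n a b := hφ.hasDegree _ _ (C.isGraded n a b)
  exact n := hφ.exact (C.exact n)

lemma CyclicResolution.ideal_map (C : CyclicResolution σ ℝ) (hφ : IsComplexification φ) :
    (C.map hφ).ideal = C.ideal.map φ := by
  rw [ideal, ideal, Ideal.map_span, ← Set.range_comp]
  rfl

lemma CyclicResolution.rank_strandD_map (C : CyclicResolution σ ℝ) (hφ : IsComplexification φ) (n : ℕ) (j : ℤ) :
    ((C.map hφ).strandD n j).rank = (C.strandD n j).rank := by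
  rw [← Matrix.rank_map_ofReal]
  congr 1
  ext a b
  exact hφ.constantCoeff _

end ScalarExtension

/-! ### The Koszul complex -/

section Koszul

/-- The quotient of the terms of `f` divisible by `X c` by `X c`, restricted to the terms whose
exponent satisfies `q`. -/
lemma exists_coeff_shift {σ K : Type*} [Field K] (c : σ) (q : (σ →₀ ℕ) → Prop) [DecidablePred q] (f : MvPolynomial σ K) :
    ∃ g : MvPolynomial σ K, ∀ m,
      coeff m g = if q m then coeff (m + Finsupp.single c 1) f else 0 := by
  classical
  refine ⟨∑ m ∈ (f.support.image fun m => m - Finsupp.single c 1).filter q,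
    monomial m (coeff (m + Finsupp.single c 1) f), fun m => ?_⟩
  rw [coeff_sum]
  simp only [coeff_monomial, Finset.sum_ite_eq', Finset.mem_filter]
  by_cases hq : q m
  · simp only [hq, and_true, if_true]
    split_ifs with h
    · rfl
    · by_contra hne
      exact h (Finset.mem_image.2 ⟨_, mem_support_iff.2 (Ne.symm hne), by simp⟩)
  · simp [hq]

variable {σ K : Type*} [Fintype σ] [Field K]

variable (K) in
/-- The sign of `e_b ∧ e_A` relative to `e_{A ∪ {b}}`, for some fixed order of the variables. -/
noncomputable def koszulSign (b : σ) (A : Finset σ) : K :=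
  (-1) ^ (A.filter fun a => Fintype.equivFin σ a < Fintype.equivFin σ b).card

lemma koszulSign_mul_self (b : σ) (A : Finset σ) : koszulSign K b A * koszulSign K b A = 1 := by
  rw [koszulSign, ← mul_pow]
  simp

variable [DecidableEq σ]

lemma koszulSign_swap {b c : σ} {A : Finset σ} (hbc : b ≠ c) (hb : b ∉ A) (hc : c ∉ A) :
    koszulSign K b A * koszulSign K c (insert b A) =
      -(koszulSign K c A * koszulSign K b (insert c A)) := by
  unfold koszulSign
  rw [Finset.filter_insert, Finset.filter_insert]
  rcases lt_or_gt_of_ne ((Fintype.equivFin σ).injective.ne hbc) with h | h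
  · rw [if_pos h, if_neg h.asymm, Finset.card_insert_of_notMem (by simp [hb]), pow_succ]
    ring
  · rw [if_neg h.asymm, if_pos h, Finset.card_insert_of_notMem (by simp [hc]), pow_succ]
    ring

variable (σ K) in
/-- The differential of the Koszul complex of the variables, in all homological degrees at once.
An element `∑ v_A e_A` of the exterior algebra is given by its coefficients `v_A`, where `A` runs
over the sets of variables. -/
noncomputable def koszulD :
    (Finset σ → MvPolynomial σ K) →ₗ[MvPolynomial σ K] (Finset σ → MvPolynomial σ K) where
  toFun v A := ∑ b ∈ Aᶜ, C (koszulSign K b A) * (X b * v (insert b A))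
  map_add' v w := by
    ext1 A
    simp only [Pi.add_apply, mul_add, Finset.sum_add_distrib]
  map_smul' f v := by
    ext1 A
    simp only [Pi.smul_apply, smul_eq_mul, Finset.mul_sum, RingHom.id_apply]
    exact Finset.sum_congr rfl fun _ _ => by ring

lemma koszulD_apply (v : Finset σ → MvPolynomial σ K) (A : Finset σ) :
    koszulD σ K v A = ∑ b ∈ Aᶜ, C (koszulSign K b A) * (X b * v (insert b A)) := rfl

lemma koszulD_congr {v w : Finset σ → MvPolynomial σ K} {A : Finset σ}
    (h : ∀ b ∉ A, v (insert b A) = w (insert b A)) : koszulD σ K v A = koszulD σ K w A :=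
  Finset.sum_congr rfl fun b hb => by rw [h b (by simpa using hb)]

lemma koszulD_eq_zero {v : Finset σ → MvPolynomial σ K} {A : Finset σ}
    (h : ∀ b ∉ A, v (insert b A) = 0) : koszulD σ K v A = 0 := by
  rw [koszulD_congr (w := 0) h, map_zero, Pi.zero_apply]

lemma koszulD_koszulD (v : Finset σ → MvPolynomial σ K) : koszulD σ K (koszulD σ K v) = 0 := by
  ext1 A
  simp only [koszulD_apply, Finset.mul_sum, Pi.zero_apply]
  rw [Finset.sum_sigma']
  refine Finset.sum_involution (fun x _ => ⟨x.2, x.1⟩) ?_ ?_ ?_ ?_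
  · rintro ⟨b, c⟩ h
    simp only [Finset.mem_sigma, Finset.mem_compl, Finset.mem_insert, not_or] at h
    have := congrArg (C (σ := σ)) (koszulSign_swap (K := K) (Ne.symm h.2.1) h.1 h.2.2)
    simp only [C_mul, C_neg] at this
    rw [Finset.insert_comm c b A]
    linear_combination (X b * X c * v (insert b (insert c A))) * this
  · rintro ⟨b, c⟩ h _ heq
    simp only [Finset.mem_sigma, Finset.mem_compl, Finset.mem_insert, not_or] at h
    exact h.2.1 (congrArg Sigma.fst heq)
  · rintro ⟨b, c⟩ h
    simp only [Finset.mem_sigma, Finset.mem_compl, Finset.mem_insert, not_or] at h ⊢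
    exact ⟨h.2.2, Ne.symm h.2.1, h.1⟩
  · rintro ⟨b, c⟩ _
    rfl

lemma hasDegree_koszulD {v : Finset σ → MvPolynomial σ K} {k : ℤ}
    (hv : ∀ A, HasDegree (v A) (k - A.card)) (A : Finset σ) :
    HasDegree (koszulD σ K v A) (k - A.card) := by
  refine HasDegree.sum fun b hb => ?_
  have h1 := (HasDegree.of_isHomogeneous (isHomogeneous_C σ (koszulSign K b A))).mul
    ((HasDegree.of_isHomogeneous (isHomogeneous_X K b)).mul (hv (insert b A)))
  rw [Finset.card_insert_of_notMem (by simpa using hb)] at h1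
  convert h1 using 1
  push_cast
  ring

/-- The Koszul complex of a set `W` of variables is exact in positive homological degrees.

In the part of multidegree `T`, the contracting homotopy is the multiplication by `e_c` followed by
the division by the variable `X c`, for any `c ∈ W` that occurs in `T`. -/
theorem koszul_exact (W : Finset σ) {v : Finset σ → MvPolynomial σ K}
    (hv : ∀ A, v A ≠ 0 → A ⊆ W ∧ A.Nonempty) (h : koszulD σ K v = 0) :
    ∃ u, (∀ A, u A ≠ 0 → A ⊆ W ∧ A.Nonempty) ∧ koszulD σ K u = v := by
  classical
  let e : Finset σ → σ →₀ ℕ := fun A => ∑ a ∈ A, Finsupp.single a 1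
  have he : ∀ (A : Finset σ) (a : σ), e A a = if a ∈ A then 1 else 0 := by
    intro A a
    simp [e, Finsupp.finsetSum_apply, Finsupp.single_apply]
  have he_insert : ∀ (A : Finset σ) (b : σ), b ∉ A → e (insert b A) = Finsupp.single b 1 + e A :=
    fun A b hb => Finset.sum_insert hb
  -- A variable in `W` that occurs in a given multidegree.
  obtain ⟨pick, hsome, hnone⟩ : ∃ pick : (σ →₀ ℕ) → Option σ,
      (∀ T c, pick T = some c → c ∈ W ∧ T c ≠ 0) ∧
        (∀ T, pick T = none → ∀ c ∈ W, T c = 0) := by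
    refine ⟨fun T => if h : ∃ c ∈ W, T c ≠ 0 then some h.choose else none, ?_, ?_⟩
    · intro T c hc
      dsimp only at hc
      split_ifs at hc with h
      rw [← Option.some_injective _ hc]
      exact h.choose_spec
    · intro T hT c hc
      dsimp only at hT
      split_ifs at hT with h
      by_contra hne
      exact h ⟨c, hc, hne⟩
  choose g hg using fun (A : Finset σ) (c : σ) => exists_coeff_shift c
    (fun m => pick (m + e A) = some c) (C (koszulSign K c (A.erase c)) * v (A.erase c))
  let u : Finset σ → MvPolynomial σ K := fun A => ∑ c ∈ A, g A c
  have hu_none : ∀ A m, pick (m + e A) = none → coeff m (u A) = 0 := by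
    intro A m hm
    rw [coeff_sum]
    exact Finset.sum_eq_zero fun c _ => by rw [hg, hm, if_neg (by simp)]
  have hu_some : ∀ A m c, pick (m + e A) = some c → c ∈ A → coeff m (u A) =
      koszulSign K c (A.erase c) * coeff (m + Finsupp.single c 1) (v (A.erase c)) := by
    intro A m c hm hc
    rw [coeff_sum, Finset.sum_eq_single_of_mem c hc, hg, if_pos hm, coeff_C_mul]
    intro b _ hb
    rw [hg, hm, if_neg (by simpa using hb.symm)]
  have hu_some' : ∀ A m c, pick (m + e A) = some c → c ∉ A → coeff m (u A) = 0 := by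
    intro A m c hm hc
    rw [coeff_sum]
    refine Finset.sum_eq_zero fun b hb => ?_
    rw [hg, hm, if_neg]
    rintro ⟨⟩
    exact hc hb
  have hcoeff : ∀ (w : Finset σ → MvPolynomial σ K) A m, coeff m (koszulD σ K w A) =
      ∑ b ∈ Aᶜ, koszulSign K b A *
        if m b ≠ 0 then coeff (m - Finsupp.single b 1) (w (insert b A)) else 0 := by
    intro w A m
    rw [koszulD_apply, coeff_sum]
    simp only [coeff_C_mul, coeff_X_mul', Finsupp.mem_support_iff]
  have hmul : ∀ {A : Finset σ} {m : σ →₀ ℕ} {b : σ}, b ∉ A → m b ≠ 0 →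
      m - Finsupp.single b 1 + e (insert b A) = m + e A := by
    intro A m b hb hm
    rw [he_insert A b hb, ← add_assoc, tsub_add_cancel_of_le]
    rw [Finsupp.single_le_iff]
    omega
  refine ⟨u, ?_, ?_⟩
  · intro A hA
    obtain ⟨m, hm⟩ := ne_zero_iff.1 hA
    cases hp : pick (m + e A) with
    | none => exact absurd (hu_none A m hp) hm
    | some c =>
      by_cases hc : c ∈ A
      · rw [hu_some A m c hp hc] at hm
        have h1 : v (A.erase c) ≠ 0 := by
          rintro h0
          simp [h0] at hm
        refine ⟨fun a ha => ?_, ⟨c, hc⟩⟩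
        by_cases hac : a = c
        · exact hac ▸ (hsome _ _ hp).1
        · exact (hv _ h1).1 (Finset.mem_erase.2 ⟨hac, ha⟩)
      · exact absurd (hu_some' A m c hp hc) hm
  · ext A m
    rw [hcoeff]
    cases hp : pick (m + e A) with
    | none =>
      have h0 : v A = 0 := by
        by_contra hne
        obtain ⟨hAW, a, ha⟩ := hv A hne
        have := hnone _ hp a (hAW ha)
        rw [Finsupp.add_apply, he, if_pos ha] at this
        omega
      rw [h0, coeff_zero]
      refine Finset.sum_eq_zero fun b hb => ?_
      rw [Finset.mem_compl] at hb
      split_ifs with hmb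
      · rw [hu_none _ _ (by rw [hmul hb hmb, hp]), mul_zero]
      · rw [mul_zero]
    | some c =>
      obtain ⟨hcW, hcT⟩ := hsome _ _ hp
      by_cases hc : c ∈ A
      · obtain ⟨A', hcA', rfl⟩ : ∃ A', c ∉ A' ∧ insert c A' = A :=
          ⟨A.erase c, Finset.notMem_erase _ _, Finset.insert_erase hc⟩
        have h1 := hcoeff v A' (m + Finsupp.single c 1)
        rw [h, Pi.zero_apply, coeff_zero,
          show A'ᶜ = insert c (insert c A')ᶜ by
            rw [Finset.compl_insert, Finset.insert_erase (by simpa using hcA')],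
          Finset.sum_insert (by simp), if_pos (by simp), add_tsub_cancel_right] at h1
        have h2 : ∀ b ∈ (insert c A')ᶜ, (koszulSign K b (insert c A') *
            if m b ≠ 0 then coeff (m - Finsupp.single b 1) (u (insert b (insert c A'))) else 0) =
            -koszulSign K c A' * (koszulSign K b A' *
              if (m + Finsupp.single c 1 : σ →₀ ℕ) b ≠ 0 then
                coeff (m + Finsupp.single c 1 - Finsupp.single b 1) (v (insert b A')) else 0) := by
          intro b hb
          rw [Finset.mem_compl] at hb
          have hb' := hb
          rw [Finset.mem_insert, not_or] at hb'
          have h3 : (m + Finsupp.single c 1 : σ →₀ ℕ) b = m b := by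
            rw [Finsupp.add_apply, Finsupp.single_eq_of_ne hb'.1, add_zero]
          rw [h3]
          split_ifs with hmb
          · rw [hu_some _ _ c (by rw [hmul hb hmb, hp]) (by simp)]
            have h4 : (insert b (insert c A')).erase c = insert b A' := by
              rw [Finset.insert_comm, Finset.erase_insert]
              simp [hcA', Ne.symm hb'.1]
            have h5 : m - Finsupp.single b 1 + Finsupp.single c 1 =
                m + Finsupp.single c 1 - Finsupp.single b 1 := by
              rw [tsub_add_eq_add_tsub]
              rw [Finsupp.single_le_iff]
              omega
            rw [h4, h5]
            have h6 := koszulSign_swap (K := K) hb'.1 hb'.2 hcA'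
            have h7 := koszulSign_mul_self (K := K) b A'
            have h8 := koszulSign_mul_self (K := K) b (insert c A')
            have h9 : koszulSign K b (insert c A') * koszulSign K c (insert b A') =
                -(koszulSign K c A' * koszulSign K b A') := by
              linear_combination (koszulSign K b A' * koszulSign K b (insert c A')) * h6 -
                koszulSign K b (insert c A') * koszulSign K c (insert b A') * h7 -
                koszulSign K c A' * koszulSign K b A' * h8
            linear_combination
              coeff (m + Finsupp.single c 1 - Finsupp.single b 1) (v (insert b A')) * h9
          · simp
        rw [Finset.sum_congr rfl h2, ← Finset.mul_sum]
        have h3 := koszulSign_mul_self (K := K) c A'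
        linear_combination koszulSign K c A' * h1 + coeff m (v (insert c A')) * h3
      · rw [Finsupp.add_apply, he, if_neg hc, add_zero] at hcT
        rw [Finset.sum_eq_single_of_mem c (by simpa using hc), if_pos hcT,
          hu_some _ _ c (by rw [hmul hc hcT, hp]) (by simp), Finset.erase_insert hc,
          ← mul_assoc, koszulSign_mul_self, one_mul, tsub_add_cancel_of_le]
        · rw [Finsupp.single_le_iff]
          omega
        · intro b hb hbc
          rw [Finset.mem_compl] at hb
          split_ifs with hmb
          · rw [hu_some' _ _ c (by rw [hmul hb hmb, hp]) (by simp [hc, Ne.symm hbc]), mul_zero]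
          · rw [mul_zero]

end Koszul

/-! ### The linear resolution of a product of two ideals generated by disjoint sets of variables -/

section Mixed

variable {σ : Type} {K : Type*} [DecidableEq σ] [Field K] (U : Finset σ)

variable (K) in
/-- The projection of the Koszul complex to the Koszul complex of the variables in `U`. -/
noncomputable def pureProj :
    (Finset σ → MvPolynomial σ K) →ₗ[MvPolynomial σ K] (Finset σ → MvPolynomial σ K) where
  toFun v A := if A ⊆ U then v A else 0
  map_add' v w := by
    ext1 A
    simp only [Pi.add_apply]
    split_ifs <;> simp
  map_smul' f v := by
    ext1 A
    simp only [Pi.smul_apply, RingHom.id_apply]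
    split_ifs <;> simp

lemma pureProj_apply (v : Finset σ → MvPolynomial σ K) (A : Finset σ) :
    pureProj K U v A = if A ⊆ U then v A else 0 := rfl

variable [Fintype σ]

/-- A set of variables is mixed if it meets both `U` and its complement. -/
def IsMixed (A : Finset σ) : Prop := ¬A ⊆ U ∧ ¬A ⊆ Uᶜ

variable {U}

lemma IsMixed.mono {A B : Finset σ} (h : IsMixed U A) (hAB : A ⊆ B) : IsMixed U B :=
  ⟨fun hB => h.1 (hAB.trans hB), fun hB => h.2 (hAB.trans hB)⟩

lemma IsMixed.insert {A : Finset σ} (h : IsMixed U A) (b : σ) : IsMixed U (insert b A) :=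
  h.mono (Finset.subset_insert _ _)

lemma not_isMixed_singleton (b : σ) : ¬IsMixed U {b} := by
  rintro ⟨h1, h2⟩
  rw [Finset.singleton_subset_iff] at h1 h2
  exact h2 (Finset.mem_compl.2 h1)

lemma not_subset_compl_of_subset {A : Finset σ} (hA : A ⊆ U) (hne : A.Nonempty) : ¬A ⊆ Uᶜ := by
  obtain ⟨a, ha⟩ := hne
  exact fun h => Finset.mem_compl.1 (h ha) (hA ha)

lemma IsMixed.one_lt_card {A : Finset σ} (h : IsMixed U A) : 1 < A.card := by
  obtain ⟨a, ha, ha'⟩ := Finset.not_subset.1 h.1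
  obtain ⟨b, hb, hb'⟩ := Finset.not_subset.1 h.2
  rw [Finset.one_lt_card]
  refine ⟨a, ha, b, hb, ?_⟩
  rintro rfl
  exact hb' (Finset.mem_compl.2 ha')

/-- The Koszul complex modulo the Koszul complexes of `U` and of its complement is exact at
the mixed sets; for pairs, the boundary of the `U`-part of the boundary has to vanish as well.

The boundary of a relative cycle is the sum of a cycle for `U` and a cycle for the complement of
`U`. Both are boundaries, and subtracting what they bound leaves a cycle of the full complex. -/
lemma koszul_mixed_exact {v : Finset σ → MvPolynomial σ K} (hv : ∀ A, v A ≠ 0 → IsMixed U A)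
    (hd : ∀ A, IsMixed U A → koszulD σ K v A = 0)
    (h0 : koszulD σ K (pureProj K U (koszulD σ K v)) ∅ = 0) :
    ∃ x, ∀ A, IsMixed U A → koszulD σ K x A = v A := by
  obtain ⟨p, hp⟩ : ∃ p, p = pureProj K U (koszulD σ K v) := ⟨_, rfl⟩
  obtain ⟨q, hq⟩ : ∃ q, q = pureProj K Uᶜ (koszulD σ K v) := ⟨_, rfl⟩
  rw [← hp] at h0
  have hempty : koszulD σ K v ∅ = 0 := koszulD_eq_zero fun b _ => by
    by_contra h
    exact not_isMixed_singleton b (by simpa using hv _ h)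
  have hpq : koszulD σ K v = p + q := by
    ext1 A
    rw [hp, hq, Pi.add_apply, pureProj_apply, pureProj_apply]
    rcases A.eq_empty_or_nonempty with rfl | hA
    · simp [hempty]
    · by_cases h1 : A ⊆ U
      · rw [if_pos h1, if_neg (not_subset_compl_of_subset h1 hA), add_zero]
      · by_cases h2 : A ⊆ Uᶜ
        · rw [if_neg h1, if_pos h2, zero_add]
        · rw [if_neg h1, if_neg h2, add_zero, hd A ⟨h1, h2⟩]
  have hdpq : koszulD σ K p + koszulD σ K q = 0 := by
    rw [← map_add, ← hpq, koszulD_koszulD]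
  have hsupp : ∀ W : Finset σ, ∀ A, pureProj K W (koszulD σ K v) A ≠ 0 → A ⊆ W ∧ A.Nonempty := by
    intro W A hA
    rw [pureProj_apply] at hA
    refine ⟨?_, ?_⟩
    · by_contra h
      exact hA (if_neg h)
    · rw [Finset.nonempty_iff_ne_empty]
      rintro rfl
      simp [hempty] at hA
  have hdp : koszulD σ K p = 0 := by
    ext1 A
    rcases A.eq_empty_or_nonempty with rfl | hA
    · exact h0
    by_cases hAU : A ⊆ U
    · have h1 : koszulD σ K q A = 0 := koszulD_eq_zero fun b _ => by
        rw [hq, pureProj_apply, if_neg]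
        exact fun hb => not_subset_compl_of_subset hAU hA ((Finset.subset_insert _ _).trans hb)
      have h2 := congrFun hdpq A
      rwa [Pi.add_apply, h1, add_zero] at h2
    · exact koszulD_eq_zero fun b _ => by
        rw [hp, pureProj_apply, if_neg]
        exact fun hb => hAU ((Finset.subset_insert _ _).trans hb)
  have hdq : koszulD σ K q = 0 := by rwa [hdp, zero_add] at hdpq
  obtain ⟨p', hp', hdp'⟩ := koszul_exact (v := p) U (fun A hA => hsupp U A (by rwa [← hp])) hdp
  obtain ⟨q', hq', hdq'⟩ := koszul_exact (v := q) Uᶜ (fun A hA => hsupp Uᶜ A (by rwa [← hq])) hdq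
  have hp0 : ∀ A, ¬A ⊆ U ∨ A = ∅ → p' A = 0 := fun A hA => by
    by_contra h
    exact hA.elim (fun h1 => h1 (hp' A h).1) (hp' A h).2.ne_empty
  have hq0 : ∀ A, ¬A ⊆ Uᶜ ∨ A = ∅ → q' A = 0 := fun A hA => by
    by_contra h
    exact hA.elim (fun h1 => h1 (hq' A h).1) (hq' A h).2.ne_empty
  have hv0 : v ∅ = 0 := by
    by_contra h
    exact (hv _ h).1 (Finset.empty_subset _)
  have hz : ∀ A, (v - p' - q') A ≠ 0 → A ⊆ Finset.univ ∧ A.Nonempty := fun A hA => by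
    refine ⟨Finset.subset_univ A, Finset.nonempty_iff_ne_empty.2 ?_⟩
    rintro rfl
    rw [Pi.sub_apply, Pi.sub_apply, hv0, hp0 _ (Or.inr rfl), hq0 _ (Or.inr rfl)] at hA
    simp at hA
  have hdz : koszulD σ K (v - p' - q') = 0 := by
    rw [map_sub, map_sub, hdp', hdq', hpq]
    abel
  obtain ⟨x, -, hx⟩ := koszul_exact Finset.univ hz hdz
  refine ⟨x, fun A hA => ?_⟩
  rw [hx, Pi.sub_apply, Pi.sub_apply, hp0 A (Or.inl hA.1), hq0 A (Or.inl hA.2), sub_zero,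
    sub_zero]

/-- The sets of variables that index the basis of the resolution: the empty set in homological
degree `0`, and the mixed sets with `n + 1` elements in homological degree `n > 0`. -/
def IsCell (U : Finset σ) : ℕ → Finset σ → Prop
  | 0, A => A = ∅
  | n + 1, A => IsMixed U A ∧ A.card = n + 2

noncomputable instance (n : ℕ) : DecidablePred (IsCell U n) := Classical.decPred _

lemma isCell_insert {n : ℕ} {A : Finset σ} (hA : IsCell U (n + 1) A) {b : σ} (hb : b ∉ A) :
    IsCell U (n + 2) (insert b A) :=
  ⟨hA.1.insert b, by rw [Finset.card_insert_of_notMem hb, hA.2]⟩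

/-- The element of the Koszul complex with the given coefficients at the cells of one homological
degree. -/
noncomputable def ofCells (n : ℕ) (w : {A // IsCell U n A} → MvPolynomial σ K) :
    Finset σ → MvPolynomial σ K :=
  fun A => if h : IsCell U n A then w ⟨A, h⟩ else 0

lemma ofCells_of_isCell {n : ℕ} (w : {A // IsCell U n A} → MvPolynomial σ K) {A : Finset σ}
    (h : IsCell U n A) : ofCells n w A = w ⟨A, h⟩ := dif_pos h

lemma isCell_of_ofCells_ne_zero {n : ℕ} {w : {A // IsCell U n A} → MvPolynomial σ K}
    {A : Finset σ} (h : ofCells n w A ≠ 0) : IsCell U n A := by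
  by_contra h'
  exact h (dif_neg h')

lemma ofCells_eq_sum (n : ℕ)
    (w : {A // IsCell U n A} → MvPolynomial σ K) :
    ofCells n w = ∑ B, w B • (Pi.single B.1 1 : Finset σ → MvPolynomial σ K) := by
  ext1 A
  rw [Finset.sum_apply]
  simp only [Pi.smul_apply, smul_eq_mul, Pi.single_apply, mul_ite, mul_one, mul_zero]
  by_cases h : IsCell U n A
  · rw [ofCells_of_isCell w h, Finset.sum_eq_single ⟨A, h⟩, if_pos rfl]
    · intro B _ hB
      exact if_neg fun hAB => hB (Subtype.ext hAB.symm)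
    · simp
  · rw [ofCells, dif_neg h]
    refine (Finset.sum_eq_zero fun B _ => if_neg ?_).symm
    rintro rfl
    exact h B.2

variable (U) in
/-- The differentials of the resolution: those of the Koszul complex modulo its subcomplexes for
`U` and for the complement of `U`, and in the lowest degree the connecting map
`e_u ∧ e_v ↦ ± X u * X v`. -/
noncomputable def mixedD : ∀ n,
    Matrix {A // IsCell U n A} {A // IsCell U (n + 1) A} (MvPolynomial σ K)
  | 0 => Matrix.of fun A B => koszulD σ K (pureProj K U (koszulD σ K (Pi.single B.1 1))) A.1
  | _ + 1 => Matrix.of fun A B => koszulD σ K (Pi.single B.1 1) A.1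

open Matrix

lemma mixedD_zero_mulVec (w : {A // IsCell U 1 A} → MvPolynomial σ K) (A) :
    (mixedD U 0 *ᵥ w) A = koszulD σ K (pureProj K U (koszulD σ K (ofCells 1 w))) A.1 := by
  simp only [ofCells_eq_sum, map_sum, map_smul, Finset.sum_apply, Pi.smul_apply, smul_eq_mul,
    mixedD, mulVec, dotProduct, Matrix.of_apply, mul_comm]

lemma mixedD_succ_mulVec (n : ℕ)
    (w : {A // IsCell U (n + 2) A} → MvPolynomial σ K) (A) :
    (mixedD U (n + 1) *ᵥ w) A = koszulD σ K (ofCells (n + 2) w) A.1 := by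
  simp only [ofCells_eq_sum, map_sum, map_smul, Finset.sum_apply, Pi.smul_apply, smul_eq_mul,
    mixedD, mulVec, dotProduct, Matrix.of_apply, mul_comm]

lemma hasDegree_koszulD_single (B A : Finset σ) :
    HasDegree (koszulD σ K (Pi.single B 1) A) ((B.card : ℤ) - A.card) := by
  refine hasDegree_koszulD (fun A => ?_) A
  rw [Pi.single_apply]
  split_ifs with h
  · subst h
    rw [sub_self]
    exact HasDegree.one
  · exact HasDegree.zero _

lemma isGraded_mixedD (n : ℕ) : (mixedD (K := K) U n).IsGraded
    (fun A => (A.1.card : ℤ)) (fun A => (A.1.card : ℤ)) := by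
  intro A B
  match n with
  | 0 =>
    refine hasDegree_koszulD (fun A => ?_) A.1
    rw [pureProj_apply]
    split_ifs
    · exact hasDegree_koszulD_single _ _
    · exact HasDegree.zero _
  | n + 1 => exact hasDegree_koszulD_single _ _

lemma constantCoeff_mixedD (n : ℕ) (A B) : constantCoeff (mixedD (K := K) U n A B) = 0 := by
  refine (isGraded_mixedD n A B).constantCoeff_eq_zero ?_
  have hB := B.2.2
  match n with
  | 0 =>
    have hA : A.1 = ∅ := A.2
    simp [hA, hB]
  | n + 1 =>
    have hA := A.2.2
    simp [hA, hB]

lemma isMixed_of_ofCells_ne_zero {n : ℕ} {w : {A // IsCell U (n + 1) A} → MvPolynomial σ K}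
    {A : Finset σ} (h : ofCells (n + 1) w A ≠ 0) : IsMixed U A := (isCell_of_ofCells_ne_zero h).1

/-- The boundary of an element of homological degree `n + 1`, which is supported on sets with `n + 2`
elements, is supported on sets with `n + 1` elements. -/
lemma koszulD_ofCells_eq_zero {n : ℕ} (y : {A // IsCell U (n + 1) A} → MvPolynomial σ K)
    {A : Finset σ} (hA : A.card ≠ n + 1) : koszulD σ K (ofCells (n + 1) y) A = 0 :=
  koszulD_eq_zero fun b hb => by
    by_contra hne
    have := (isCell_of_ofCells_ne_zero hne).2
    rw [Finset.card_insert_of_notMem hb] at this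
    omega

/-- Sets containing a mixed set are mixed, so that boundaries at mixed sets only involve the
coefficients at mixed sets. -/
lemma exists_mixedD_mulVec_eq {n : ℕ} {w : {A // IsCell U (n + 1) A} → MvPolynomial σ K}
    {x : Finset σ → MvPolynomial σ K}
    (hx : ∀ A, IsMixed U A → koszulD σ K x A = ofCells (n + 1) w A) :
    ∃ y, mixedD U (n + 1) *ᵥ y = w := by
  refine ⟨fun B => x B.1, funext fun A => ?_⟩
  rw [mixedD_succ_mulVec, ← ofCells_of_isCell w A.2, ← hx A.1 A.2.1]
  exact koszulD_congr fun b hb => ofCells_of_isCell _ (isCell_insert A.2 hb)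

lemma ofCells_mixedD_mulVec {n : ℕ} (y : {A // IsCell U (n + 2) A} → MvPolynomial σ K)
    {A : Finset σ} (hA : IsMixed U A) :
    ofCells (n + 1) (mixedD U (n + 1) *ᵥ y) A = koszulD σ K (ofCells (n + 2) y) A := by
  by_cases h : IsCell U (n + 1) A
  · rw [ofCells_of_isCell _ h, mixedD_succ_mulVec]
  · rw [ofCells, dif_neg h, koszulD_ofCells_eq_zero]
    exact fun hcard => h ⟨hA, hcard⟩

lemma exact_mixedD_zero : Function.Exact (mixedD (K := K) U 1).mulVec (mixedD U 0).mulVec := by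
  intro w
  constructor
  · intro hw
    obtain ⟨x, hx⟩ := koszul_mixed_exact (v := ofCells 1 w)
      (fun _ => isMixed_of_ofCells_ne_zero)
      (fun A hA => koszulD_ofCells_eq_zero w (by have := hA.one_lt_card; omega))
      (by rw [← mixedD_zero_mulVec w ⟨∅, rfl⟩, hw]; rfl)
    exact exists_mixedD_mulVec_eq hx
  · rintro ⟨y, rfl⟩
    ext1 ⟨A, hA⟩
    obtain rfl : A = ∅ := hA
    rw [mixedD_zero_mulVec, Pi.zero_apply]
    set v := koszulD σ K (ofCells 2 y) with hv
    -- On singletons, the `U`-part of the boundary of the mixed part of `v` is the negative of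
    -- the boundary of the `U`-part of `v`.
    have h1 : ∀ b ∉ (∅ : Finset σ),
        pureProj K U (koszulD σ K (ofCells 1 (mixedD U 1 *ᵥ y))) (insert b ∅) =
          (-koszulD σ K (pureProj K U v)) (insert b ∅) := by
      intro b _
      rw [pureProj_apply, Pi.neg_apply]
      split_ifs with hb
      · rw [eq_neg_iff_add_eq_zero, ← Pi.add_apply, ← map_add]
        have h2 : koszulD σ K v (insert b ∅) = 0 := by rw [hv, koszulD_koszulD]; rfl
        rw [← h2]
        refine koszulD_congr fun c hc => ?_
        rw [Pi.add_apply, pureProj_apply]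
        split_ifs with hcU
        · rw [ofCells, dif_neg fun h => h.1.1 hcU, zero_add]
        · rw [add_zero, ofCells_mixedD_mulVec y ⟨hcU, fun h => not_subset_compl_of_subset hb
            (Finset.insert_nonempty _ _) ((Finset.subset_insert _ _).trans h)⟩]
      · rw [koszulD_eq_zero, neg_zero]
        intro c _
        exact if_neg fun h => hb ((Finset.subset_insert _ _).trans h)
    rw [koszulD_congr h1, map_neg, koszulD_koszulD, neg_zero, Pi.zero_apply]

lemma exact_mixedD_succ (n : ℕ) :
    Function.Exact (mixedD (K := K) U (n + 2)).mulVec (mixedD U (n + 1)).mulVec := by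
  intro w
  constructor
  · intro hw
    obtain ⟨x, hx⟩ := koszul_mixed_exact (v := ofCells (n + 2) w)
      (fun _ => isMixed_of_ofCells_ne_zero)
      (fun A hA => by
        by_cases h : A.card = n + 2
        · rw [← mixedD_succ_mulVec n w ⟨A, hA, h⟩, hw]
          rfl
        · exact koszulD_ofCells_eq_zero w h)
      (koszulD_eq_zero fun b _ => by
        rw [pureProj_apply, koszulD_ofCells_eq_zero w (by simp), ite_self])
    exact exists_mixedD_mulVec_eq hx
  · rintro ⟨y, rfl⟩
    ext1 A
    rw [mixedD_succ_mulVec, Pi.zero_apply, koszulD_congr (w := koszulD σ K (ofCells (n + 3) y)),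
      koszulD_koszulD, Pi.zero_apply]
    exact fun b _ => ofCells_mixedD_mulVec y (A.2.1.insert b)

variable (K U) in
/-- The minimal graded free resolution of `S / 𝔲 𝔳`, where `𝔲` is generated by the variables in `U`
and `𝔳` by the other ones. -/
noncomputable def mixedResolution : CyclicResolution σ K where
  ι n := {A // IsCell U n A}
  fintype _ := inferInstance
  decEq _ := inferInstance
  unique := ⟨⟨⟨∅, rfl⟩⟩, fun A => Subtype.ext A.2⟩
  deg _ A := A.1.card
  deg_zero A := by rw [show A.1 = ∅ from A.2]; rfl
  d := mixedD U
  isGraded := isGraded_mixedD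
  exact
    | 0 => exact_mixedD_zero
    | n + 1 => exact_mixedD_succ n

lemma mixedD_pair {u v : σ} (hu : u ∈ U) (hv : v ∉ U) (h : IsCell U 1 {u, v}) :
    mixedD (K := K) U 0 ⟨∅, rfl⟩ ⟨{u, v}, h⟩ =
      C (koszulSign K u ∅ * koszulSign K v {u}) * (X u * X v) := by
  have huv : u ≠ v := fun huv => hv (huv ▸ hu)
  have hsub : ∀ b c : σ, b ∈ U → insert c {b} = ({u, v} : Finset σ) → b = u ∧ (c ≠ b → c = v) := by
    intro b c hb hbc
    have h1 : b ∈ ({u, v} : Finset σ) := hbc ▸ by simp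
    have h2 : c ∈ ({u, v} : Finset σ) := hbc ▸ by simp
    simp only [Finset.mem_insert, Finset.mem_singleton] at h1 h2
    have h3 : b = u := h1.resolve_right (by rintro rfl; exact hv hb)
    subst h3
    exact ⟨rfl, fun hcb => h2.resolve_left hcb⟩
  change koszulD σ K (pureProj K U (koszulD σ K (Pi.single {u, v} 1))) ∅ = _
  rw [koszulD_apply, Finset.sum_eq_single_of_mem u (by simp)]
  · rw [pureProj_apply, if_pos (by simpa using hu), koszulD_apply,
      Finset.sum_eq_single_of_mem v (by simpa using huv.symm)]
    · rw [insert_empty_eq, Finset.pair_comm v u, Pi.single_eq_same, C_mul]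
      ring
    · intro c hc hcv
      rw [Pi.single_eq_of_ne, mul_zero, mul_zero]
      rw [insert_empty_eq] at hc ⊢
      intro hcu
      exact hcv ((hsub u c hu hcu).2 (by simpa using hc))
  · intro b _ hb
    rw [pureProj_apply]
    split_ifs with hbU
    · rw [koszulD_eq_zero, mul_zero, mul_zero]
      intro c _
      rw [Pi.single_eq_of_ne]
      rw [insert_empty_eq] at hbU ⊢
      exact fun hcb => hb (hsub b c (by simpa using hbU) hcb).1
    · rw [mul_zero, mul_zero]

lemma ideal_mixedResolution :
    (mixedResolution K U).ideal =
    Ideal.span (Set.image X (U : Set σ)) * Ideal.span (Set.image X (U : Set σ)ᶜ) := by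
  have hunit : ∀ u v : σ, IsUnit (C (koszulSign K u ∅ * koszulSign K v {u}) : MvPolynomial σ K) := by
    intro u v
    exact (IsUnit.mul (IsUnit.of_mul_eq_one _ (koszulSign_mul_self u ∅))
      (IsUnit.of_mul_eq_one _ (koszulSign_mul_self v {u}))).map C
  rw [Ideal.span_mul_span']
  apply le_antisymm
  · refine Ideal.span_le.2 ?_
    rintro _ ⟨⟨B, hB⟩, rfl⟩
    obtain ⟨v, hvB, hv⟩ := Finset.not_subset.1 hB.1.1
    obtain ⟨u, huB, hu⟩ := Finset.not_subset.1 hB.1.2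
    rw [Finset.mem_compl, not_not] at hu
    have huv : u ≠ v := fun huv => hv (huv ▸ hu)
    obtain rfl : {u, v} = B := by
      refine Finset.eq_of_subset_of_card_le ?_ ?_
      · intro a ha
        rw [Finset.mem_insert, Finset.mem_singleton] at ha
        rcases ha with rfl | rfl <;> assumption
      · rw [hB.2, Finset.card_pair huv]
    have h1 : (mixedResolution K U).d 0 default ⟨{u, v}, hB⟩ = _ := mixedD_pair (K := K) hu hv hB
    rw [h1]
    exact Ideal.mul_mem_left _ _
      (Ideal.subset_span (Set.mul_mem_mul ⟨u, hu, rfl⟩ ⟨v, hv, rfl⟩))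
  · refine Ideal.span_le.2 ?_
    rintro _ ⟨_, ⟨u, hu, rfl⟩, _, ⟨v, hv, rfl⟩, rfl⟩
    have hB : IsCell U 1 {u, v} := ⟨⟨fun h => hv (h (by simp)), fun h =>
      Finset.mem_compl.1 (h (Finset.mem_insert_self _ _)) hu⟩,
        Finset.card_pair fun huv => hv (huv ▸ hu)⟩
    have h1 : (mixedResolution K U).d 0 default ⟨{u, v}, hB⟩ = _ := mixedD_pair (K := K) hu hv hB
    rw [SetLike.mem_coe, ← Ideal.unit_mul_mem_iff_mem _ (hunit u v)]
    exact h1 ▸ Ideal.subset_span ⟨_, rfl⟩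

lemma card_isCell_add (n : ℕ) : Fintype.card {A // IsCell U (n + 1) A} +
    (U.card.choose (n + 2) + Uᶜ.card.choose (n + 2)) = (Fintype.card σ).choose (n + 2) := by
  rw [Fintype.card_subtype, ← Finset.card_powersetCard, ← Finset.card_powersetCard,
    ← Finset.card_univ (α := σ), ← Finset.card_powersetCard, ← Finset.card_union_of_disjoint,
    ← Finset.card_union_of_disjoint]
  · congr 1
    ext A
    rw [Finset.mem_union, Finset.mem_union, Finset.mem_filter_univ, Finset.mem_powersetCard,
      Finset.mem_powersetCard, Finset.mem_powersetCard, IsCell, IsMixed]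
    have := Finset.subset_univ A
    tauto
  · rw [Finset.disjoint_left]
    intro A hA hA'
    rw [Finset.mem_filter_univ, IsCell, IsMixed] at hA
    rw [Finset.mem_union, Finset.mem_powersetCard, Finset.mem_powersetCard] at hA'
    tauto
  · rw [Finset.disjoint_left]
    intro A hA hA'
    rw [Finset.mem_powersetCard] at hA hA'
    refine not_subset_compl_of_subset hA.1 ?_ hA'.1
    rw [← Finset.card_pos]
    omega

lemma card_strand_mixedResolution (n : ℕ) (j : ℤ) :
    Fintype.card {c // (mixedResolution K U).deg (n + 1) c = j} =
      if j = n + 2 then Fintype.card {A // IsCell U (n + 1) A} else 0 := by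
  have hdeg : ∀ c, (mixedResolution K U).deg (n + 1) c = n + 2 := fun c => by
    have := c.2.2
    change (c.1.card : ℤ) = _
    rw [this]
    rfl
  split_ifs with h
  · subst h
    exact Fintype.card_congr (Equiv.subtypeUnivEquiv hdeg)
  · refine Fintype.card_eq_zero_iff.2 ⟨fun c => h ?_⟩
    rw [← c.2, hdeg]

end Mixed

/-! ### Ideals generated by variables -/

section VariableIdeals

variable {σ K : Type*} [Field K]

/-- If `θ` kills the variables in `s` and has a left inverse on the other ones, then its kernel is
generated by the variables in `s`. -/
lemma ker_eq_span_X_image {A : Type*} [CommRing A] [Algebra K A] {s : Set σ}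
    (θ : MvPolynomial σ K →ₐ[K] A) (ρ : A →ₐ[K] MvPolynomial σ K)
    (h0 : ∀ i ∈ s, θ (X i) = 0) (h1 : ∀ i ∉ s, ρ (θ (X i)) = X i) :
    RingHom.ker θ = Ideal.span (X '' s) := by
  apply le_antisymm
  · intro f hf
    have h2 : (Ideal.Quotient.mkₐ K (Ideal.span (X '' s))).comp (ρ.comp θ) =
        Ideal.Quotient.mkₐ K (Ideal.span (X '' s)) := by
      refine MvPolynomial.algHom_ext fun i => ?_
      by_cases hi : i ∈ s
      · simp only [AlgHom.comp_apply, h0 i hi, map_zero]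
        exact (Ideal.Quotient.eq_zero_iff_mem.2 (Ideal.subset_span (Set.mem_image_of_mem X hi))).symm
      · simp only [AlgHom.comp_apply, h1 i hi]
    have h3 := congrArg (fun g => g f) h2
    simp only [AlgHom.comp_apply] at h3
    rw [(RingHom.mem_ker).1 hf, map_zero, map_zero] at h3
    exact Ideal.Quotient.eq_zero_iff_mem.1 h3.symm
  · refine Ideal.span_le.2 ?_
    rintro _ ⟨i, hi, rfl⟩
    exact h0 i hi

lemma isPrime_span_X_image (s : Set σ) :
    (Ideal.span (X '' s) : Ideal (MvPolynomial σ K)).IsPrime := by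
  classical
  rw [← ker_eq_span_X_image (aeval fun i => if i ∈ s then 0 else X i) (AlgHom.id K _)
    (fun i hi => by simp [hi]) (fun i hi => by simp [hi])]
  exact RingHom.ker_isPrime _

lemma X_mem_span_X_image_iff {s : Set σ} {i : σ} :
    (X i : MvPolynomial σ K) ∈ Ideal.span (X '' s) ↔ i ∈ s := by
  classical
  rw [mem_ideal_span_X_image, support_X]
  simp [Finsupp.single_apply]

lemma isHomogeneous_span_X_image (s : Set σ) :
    (Ideal.span (X '' s) : Ideal (MvPolynomial σ K)).IsHomogeneous (homogeneousSubmodule σ K) := by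
  apply Ideal.homogeneous_span
  rintro _ ⟨j, -, rfl⟩
  exact ⟨1, isHomogeneous_X _ _⟩

lemma span_X_image_mul {s t : Set σ} (hst : Disjoint s t) :
    (Ideal.span (X '' s) * Ideal.span (X '' t) : Ideal (MvPolynomial σ K)) =
      Ideal.span (X '' s) ⊓ Ideal.span (X '' t) := by
  apply le_antisymm Ideal.mul_le_inf
  rintro f ⟨hs, ht⟩
  rw [SetLike.mem_coe, mem_ideal_span_X_image] at hs ht
  rw [f.as_sum]
  refine Ideal.sum_mem _ fun m hm => ?_
  obtain ⟨i, hi, hmi⟩ := hs m hm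
  obtain ⟨j, hj, hmj⟩ := ht m hm
  have hij : i ≠ j := fun hij => Set.disjoint_left.1 hst hi (hij ▸ hj)
  have h1 : (monomial m (coeff m f) : MvPolynomial σ K) =
      monomial (m - Finsupp.single i 1 - Finsupp.single j 1) (coeff m f) * (X i * X j) := by
    rw [X, X, monomial_mul, monomial_mul, mul_one, mul_one]
    congr 1
    have h2 : Finsupp.single j 1 ≤ m - Finsupp.single i 1 := by
      rw [Finsupp.single_le_iff, Finsupp.tsub_apply, Finsupp.single_eq_of_ne hij.symm]
      omega
    have h3 : Finsupp.single i 1 ≤ m := by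
      rw [Finsupp.single_le_iff]
      omega
    rw [add_comm (Finsupp.single i 1), ← add_assoc, tsub_add_cancel_of_le h2,
      tsub_add_cancel_of_le h3]
  rw [h1]
  exact Ideal.mul_mem_left _ _ (Ideal.mul_mem_mul (Ideal.subset_span ⟨i, hi, rfl⟩)
    (Ideal.subset_span ⟨j, hj, rfl⟩))

end VariableIdeals

/-! ### The linear change of coordinates -/

section Coordinates

variable (h : ℕ)

/-- The substitution `y_j ↦ (u_j + v_j) / 2`, `z_j ↦ (u_j - v_j) / 2i`. -/
noncomputable def toUV :
    MvPolynomial (Fin h ⊕ Fin h) ℂ →ₐ[ℂ] MvPolynomial (Fin h ⊕ Fin h) ℂ :=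
  aeval (Sum.elim (fun j => C (1 / 2) * (X (Sum.inl j) + X (Sum.inr j)))
    (fun j => C (-Complex.I / 2) * (X (Sum.inl j) - X (Sum.inr j))))

/-- The substitution `u_j ↦ y_j + i z_j`, `v_j ↦ y_j - i z_j`. -/
noncomputable def toYZ :
    MvPolynomial (Fin h ⊕ Fin h) ℂ →ₐ[ℂ] MvPolynomial (Fin h ⊕ Fin h) ℂ :=
  aeval (Sum.elim (fun j => X (Sum.inl j) + C Complex.I * X (Sum.inr j))
    (fun j => X (Sum.inl j) - C Complex.I * X (Sum.inr j)))

lemma toUV_X_inl (j : Fin h) :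
    toUV h (X (Sum.inl j)) = C (1 / 2) * (X (Sum.inl j) + X (Sum.inr j)) := aeval_X _ _

lemma toUV_X_inr (j : Fin h) :
    toUV h (X (Sum.inr j)) = C (-Complex.I / 2) * (X (Sum.inl j) - X (Sum.inr j)) := aeval_X _ _

lemma toYZ_X_inl (j : Fin h) :
    toYZ h (X (Sum.inl j)) = X (Sum.inl j) + C Complex.I * X (Sum.inr j) := aeval_X _ _

lemma toYZ_X_inr (j : Fin h) :
    toYZ h (X (Sum.inr j)) = X (Sum.inl j) - C Complex.I * X (Sum.inr j) := aeval_X _ _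

lemma C_neg_I_div_two_mul_C_I {σ : Type*} :
    (C (-Complex.I / 2) : MvPolynomial σ ℂ) * C Complex.I = C (1 / 2) := by
  rw [← C_mul]
  congr 1
  linear_combination (-1 / 2 : ℂ) * Complex.I_mul_I

lemma C_half_add_C_half {σ : Type*} : (C (1 / 2) : MvPolynomial σ ℂ) + C (1 / 2) = 1 := by
  rw [← C_add, ← C_1]
  norm_num

lemma toUV_add (j : Fin h) :
    toUV h (X (Sum.inl j) + C Complex.I * X (Sum.inr j)) = X (Sum.inl j) := by
  rw [map_add, map_mul, toUV_X_inl, toUV_X_inr, algHom_C, algebraMap_eq]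
  linear_combination (X (Sum.inl j) - X (Sum.inr j)) * C_neg_I_div_two_mul_C_I +
    X (Sum.inl j) * C_half_add_C_half

lemma toUV_sub (j : Fin h) :
    toUV h (X (Sum.inl j) - C Complex.I * X (Sum.inr j)) = X (Sum.inr j) := by
  rw [map_sub, map_mul, toUV_X_inl, toUV_X_inr, algHom_C, algebraMap_eq]
  linear_combination (X (Sum.inr j) - X (Sum.inl j)) * C_neg_I_div_two_mul_C_I +
    X (Sum.inr j) * C_half_add_C_half

lemma toUV_comp_toYZ : (toUV h).comp (toYZ h) = AlgHom.id ℂ _ := by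
  refine MvPolynomial.algHom_ext fun i => ?_
  rcases i with j | j
  · rw [AlgHom.comp_apply, toYZ_X_inl, toUV_add, AlgHom.id_apply]
  · rw [AlgHom.comp_apply, toYZ_X_inr, toUV_sub, AlgHom.id_apply]

lemma toYZ_comp_toUV : (toYZ h).comp (toUV h) = AlgHom.id ℂ _ := by
  refine MvPolynomial.algHom_ext fun i => ?_
  rcases i with j | j
  · rw [AlgHom.comp_apply, toUV_X_inl, map_mul, map_add, toYZ_X_inl, toYZ_X_inr, AlgHom.id_apply,
      algHom_C, algebraMap_eq]
    linear_combination X (Sum.inl j) * C_half_add_C_half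
  · rw [AlgHom.comp_apply, toUV_X_inr, map_mul, map_sub, toYZ_X_inl, toYZ_X_inr, AlgHom.id_apply,
      algHom_C, algebraMap_eq]
    linear_combination 2 * X (Sum.inr j) * C_neg_I_div_two_mul_C_I +
      X (Sum.inr j) * C_half_add_C_half

/-- The change of coordinates with `y_j + i z_j ↦ u_j` and `y_j - i z_j ↦ v_j`. -/
noncomputable def coordChange :
    MvPolynomial (Fin h ⊕ Fin h) ℂ ≃ₐ[ℂ] MvPolynomial (Fin h ⊕ Fin h) ℂ :=
  AlgEquiv.ofAlgHom (toUV h) (toYZ h) (toUV_comp_toYZ h) (toYZ_comp_toUV h)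

lemma coordChange_C (c : ℂ) : coordChange h (C c) = C c := (coordChange h).commutes c

/-- The inclusion of the real polynomials in `y_j`, `z_j` into the complex polynomials in
`u_j = y_j + i z_j`, `v_j = y_j - i z_j`. -/
noncomputable def realToComplex :
    MvPolynomial (Fin h ⊕ Fin h) ℝ →+* MvPolynomial (Fin h ⊕ Fin h) ℂ :=
  (coordChange h : MvPolynomial (Fin h ⊕ Fin h) ℂ →+* MvPolynomial (Fin h ⊕ Fin h) ℂ).comp
    (MvPolynomial.map (algebraMap ℝ ℂ))

lemma realToComplex_apply (f : MvPolynomial (Fin h ⊕ Fin h) ℝ) :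
    realToComplex h f = coordChange h (MvPolynomial.map (algebraMap ℝ ℂ) f) := rfl

@[simp]
lemma realToComplex_X_inl (j : Fin h) : realToComplex h (X (Sum.inl j)) =
    C (1 / 2) * (X (Sum.inl j) + X (Sum.inr j)) := by
  rw [realToComplex_apply, map_X]
  exact toUV_X_inl h j

@[simp]
lemma realToComplex_X_inr (j : Fin h) : realToComplex h (X (Sum.inr j)) =
    C (-Complex.I / 2) * (X (Sum.inl j) - X (Sum.inr j)) := by
  rw [realToComplex_apply, map_X]
  exact toUV_X_inr h j

@[simp]
lemma realToComplex_C (c : ℝ) : realToComplex h (C c) = C (c : ℂ) := by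
  rw [realToComplex_apply, map_C, coordChange_C]
  rfl

lemma isHomogeneous_realToComplex {f : MvPolynomial (Fin h ⊕ Fin h) ℝ} {n : ℕ}
    (hf : f.IsHomogeneous n) : (realToComplex h f).IsHomogeneous n := by
  have h1 := (hf.map (algebraMap ℝ ℂ)).aeval
    (Sum.elim (fun j => C (1 / 2) * (X (Sum.inl j) + X (Sum.inr j)))
      (fun j => C (-Complex.I / 2) * (X (Sum.inl j) - X (Sum.inr j))) :
        Fin h ⊕ Fin h → MvPolynomial (Fin h ⊕ Fin h) ℂ) (n := 1) (by
      rintro (j | j)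
      · exact ((isHomogeneous_X _ _).add (isHomogeneous_X _ _)).C_mul _
      · exact ((isHomogeneous_X _ _).sub (isHomogeneous_X _ _)).C_mul _)
  rwa [one_mul] at h1

lemma isComplexification_realToComplex : IsComplexification (realToComplex h) where
  hasDegree f n hf := by
    by_cases h0 : f = 0
    · rw [h0, map_zero]
      exact HasDegree.zero n
    · obtain ⟨m, hm⟩ := ne_zero_iff.1 h0
      obtain rfl := hf m (mem_support_iff.2 hm)
      refine HasDegree.of_isHomogeneous (isHomogeneous_realToComplex h fun m' hm' => ?_)
      have h1 := hf m' (mem_support_iff.2 hm')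
      rw [Finsupp.degree_eq_weight_one] at h1 ⊢
      exact_mod_cast h1
  constantCoeff f := by
    have : constantCoeff.comp (realToComplex h) = (algebraMap ℝ ℂ).comp constantCoeff := by
      refine MvPolynomial.ringHom_ext (fun c => by simp) ?_
      rintro (j | j) <;> simp
    exact congrArg (fun g => g f) this
  exists_eq f := by
    have key : ∀ g : MvPolynomial (Fin h ⊕ Fin h) ℂ, ∃ a b : MvPolynomial (Fin h ⊕ Fin h) ℝ,
        g = MvPolynomial.map (algebraMap ℝ ℂ) a +
          C Complex.I * MvPolynomial.map (algebraMap ℝ ℂ) b := by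
      intro g
      induction g using MvPolynomial.induction_on with
      | C c =>
        refine ⟨C c.re, C c.im, ?_⟩
        rw [map_C, map_C, ← C_mul, ← C_add]
        congr 1
        simp [mul_comm Complex.I, Complex.re_add_im]
      | add p q hp hq =>
        obtain ⟨a, b, rfl⟩ := hp
        obtain ⟨a', b', rfl⟩ := hq
        refine ⟨a + a', b + b', ?_⟩
        rw [map_add, map_add]
        ring
      | mul_X p i hp =>
        obtain ⟨a, b, rfl⟩ := hp
        refine ⟨a * X i, b * X i, ?_⟩
        rw [map_mul, map_mul, map_X]
        ring
    obtain ⟨a, b, hab⟩ := key ((coordChange h).symm f)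
    refine ⟨a, b, ?_⟩
    rw [← (coordChange h).apply_symm_apply f, hab, map_add, map_mul, coordChange_C]
    rfl
  eq_zero a b hab := by
    have h1 : MvPolynomial.map (algebraMap ℝ ℂ) a +
        C Complex.I * MvPolynomial.map (algebraMap ℝ ℂ) b = 0 := by
      apply (coordChange h).injective
      rw [map_add, map_mul, coordChange_C, map_zero]
      exact hab
    have h2 : ∀ m, ((coeff m a : ℝ) : ℂ) + Complex.I * ((coeff m b : ℝ) : ℂ) = 0 := fun m => by
      have := congrArg (coeff m) h1
      rwa [coeff_add, coeff_C_mul, coeff_map, coeff_map, coeff_zero] at this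
    constructor <;> ext m
    · simpa using congrArg Complex.re (h2 m)
    · simpa using congrArg Complex.im (h2 m)

lemma homogeneousComponent_realToComplex (f : MvPolynomial (Fin h ⊕ Fin h) ℝ) (n : ℕ) :
    homogeneousComponent n (realToComplex h f) = realToComplex h (homogeneousComponent n f) := by
  conv_lhs => rw [← sum_homogeneousComponent f, map_sum, map_sum]
  have h1 : ∀ i, homogeneousComponent n (realToComplex h (homogeneousComponent i f)) =
      if i = n then realToComplex h (homogeneousComponent n f) else 0 := fun i => by
    rw [homogeneousComponent_of_mem (isHomogeneous_realToComplex h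
      (homogeneousComponent_isHomogeneous i f))]
    split_ifs with h1 h2 h2 <;> simp_all
  simp only [h1, Finset.sum_ite_eq', Finset.mem_range]
  split_ifs with h2
  · rfl
  · rw [homogeneousComponent_eq_zero _ _ (by omega), map_zero]

lemma isHomogeneous_comap_realToComplex {J : Ideal (MvPolynomial (Fin h ⊕ Fin h) ℂ)}
    (hJ : J.IsHomogeneous (homogeneousSubmodule (Fin h ⊕ Fin h) ℂ)) :
    (J.comap (realToComplex h)).IsHomogeneous (homogeneousSubmodule (Fin h ⊕ Fin h) ℝ) := by
  intro i f hf
  have h1 : realToComplex h (homogeneousComponent i f) ∈ J := by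
    rw [← homogeneousComponent_realToComplex]
    exact homogeneousComponent_mem_of_mem hJ hf i
  have h2 := decomposition.decompose'_apply f i
  rw [← h2] at h1
  exact h1

end Coordinates

/-! ### The prime ideal as a contraction -/

section Contraction

variable (h : ℕ)

lemma presentationMap_X_inl (j : Fin h) : presentationMap h (X (Sum.inl j)) = X j := aeval_X _ _

lemma presentationMap_X_inr (j : Fin h) :
    presentationMap h (X (Sum.inr j)) = C Complex.I * X j := aeval_X _ _

lemma C_I_mul_C_I {σ : Type*} : (C Complex.I : MvPolynomial σ ℂ) * C Complex.I = -1 := by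
  rw [← C_mul, Complex.I_mul_I, C_neg, C_1]

lemma realToComplex_add (j : Fin h) : realToComplex h (X (Sum.inl j)) +
    C Complex.I * realToComplex h (X (Sum.inr j)) = X (Sum.inl j) := by
  have h1 := toUV_add h j
  rw [map_add, map_mul, toUV_X_inl, toUV_X_inr, algHom_C, algebraMap_eq] at h1
  rw [realToComplex_X_inl, realToComplex_X_inr]
  exact h1

lemma realToComplex_sub (j : Fin h) : realToComplex h (X (Sum.inl j)) -
    C Complex.I * realToComplex h (X (Sum.inr j)) = X (Sum.inr j) := by
  have h1 := toUV_sub h j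
  rw [map_sub, map_mul, toUV_X_inl, toUV_X_inr, algHom_C, algebraMap_eq] at h1
  rw [realToComplex_X_inl, realToComplex_X_inr]
  exact h1

/-- The ideal `𝔭` is the contraction of the ideal `(u_1, …, u_h)`, which is the kernel of
`u_j ↦ 0`, `v_j ↦ 2 x_j`. -/
lemma ker_presentationMap : RingHom.ker (presentationMap h) =
    (Ideal.span (X '' Set.range Sum.inl)).comap (realToComplex h) := by
  let θ : MvPolynomial (Fin h ⊕ Fin h) ℂ →ₐ[ℂ] MvPolynomial (Fin h) ℂ :=
    aeval (Sum.elim (fun _ => 0) (fun j => C 2 * X j))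
  have hθl : ∀ j, θ (X (Sum.inl j)) = 0 := fun j => aeval_X _ _
  have hθr : ∀ j, θ (X (Sum.inr j)) = C 2 * X j := fun j => aeval_X _ _
  have hθC : ∀ c, θ (C c) = C c := fun c => algHom_C _ _
  have hker : RingHom.ker θ = Ideal.span (X '' Set.range Sum.inl) := by
    refine ker_eq_span_X_image θ (aeval fun j => C (1 / 2) * X (Sum.inr j)) ?_ ?_
    · rintro _ ⟨j, rfl⟩
      exact hθl j
    · rintro (j | j) hj
      · exact absurd ⟨j, rfl⟩ hj
      · rw [hθr, map_mul, aeval_X, algHom_C, algebraMap_eq, ← mul_assoc, ← C_mul]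
        norm_num
  have hcomp : (θ : MvPolynomial (Fin h ⊕ Fin h) ℂ →+* MvPolynomial (Fin h) ℂ).comp (realToComplex h) = ((presentationMap h : MvPolynomial (Fin h ⊕ Fin h) ℝ →ₐ[ℝ] MvPolynomial (Fin h) ℂ) :
        MvPolynomial (Fin h ⊕ Fin h) ℝ →+* MvPolynomial (Fin h) ℂ) := by
    refine MvPolynomial.ringHom_ext (fun c => ?_) ?_
    · simp only [RingHom.comp_apply, RingHom.coe_coe, realToComplex_C, hθC, algHom_C]
      rfl
    · rintro (j | j)
      · simp only [RingHom.comp_apply, RingHom.coe_coe, realToComplex_X_inl, map_mul, map_add, hθl,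
          hθr, hθC, presentationMap_X_inl, zero_add]
        rw [← mul_assoc, ← C_mul]
        norm_num
      · simp only [RingHom.comp_apply, RingHom.coe_coe, realToComplex_X_inr, map_mul, map_sub, hθl,
          hθr, hθC, presentationMap_X_inr, zero_sub]
        rw [mul_neg, ← mul_assoc, ← C_mul, ← neg_mul, ← C_neg]
        congr 2
        ring
  rw [← hker]
  ext f
  exact (congrArg (fun g => g f = 0) hcomp).symm.to_iff

/-- The ideal `𝔭` is also contained in the contraction of `(v_1, …, v_h)`, because complex
conjugation of the coefficients exchanges `u_j` and `v_j`. -/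
lemma ker_presentationMap_le : RingHom.ker (presentationMap h) ≤
    (Ideal.span (X '' Set.range Sum.inr)).comap (realToComplex h) := by
  let θ : MvPolynomial (Fin h ⊕ Fin h) ℂ →ₐ[ℂ] MvPolynomial (Fin h) ℂ :=
    aeval (Sum.elim (fun j => C 2 * X j) (fun _ => 0))
  have hθl : ∀ j, θ (X (Sum.inl j)) = C 2 * X j := fun j => aeval_X _ _
  have hθr : ∀ j, θ (X (Sum.inr j)) = 0 := fun j => aeval_X _ _
  have hθC : ∀ c, θ (C c) = C c := fun c => algHom_C _ _
  have hker : RingHom.ker θ = Ideal.span (X '' Set.range Sum.inr) := by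
    refine ker_eq_span_X_image θ (aeval fun j => C (1 / 2) * X (Sum.inl j)) ?_ ?_
    · rintro _ ⟨j, rfl⟩
      exact hθr j
    · rintro (j | j) hj
      · rw [hθl, map_mul, aeval_X, algHom_C, algebraMap_eq, ← mul_assoc, ← C_mul]
        norm_num
      · exact absurd ⟨j, rfl⟩ hj
  have hcomp : (θ : MvPolynomial (Fin h ⊕ Fin h) ℂ →+* MvPolynomial (Fin h) ℂ).comp (realToComplex h) =
      (MvPolynomial.map (starRingEnd ℂ)).comp ((presentationMap h : MvPolynomial (Fin h ⊕ Fin h) ℝ →ₐ[ℝ] MvPolynomial (Fin h) ℂ) :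
        MvPolynomial (Fin h ⊕ Fin h) ℝ →+* MvPolynomial (Fin h) ℂ) := by
    refine MvPolynomial.ringHom_ext (fun c => ?_) ?_
    · simp only [RingHom.comp_apply, RingHom.coe_coe, realToComplex_C, hθC, algHom_C]
      exact ((map_C _ _).trans (congrArg C (Complex.conj_ofReal c))).symm
    · rintro (j | j)
      · simp only [RingHom.comp_apply, RingHom.coe_coe, realToComplex_X_inl, map_mul, map_add, hθl,
          hθr, hθC, presentationMap_X_inl, add_zero, map_X]
        rw [← mul_assoc, ← C_mul]
        norm_num
      · simp only [RingHom.comp_apply, RingHom.coe_coe, realToComplex_X_inr, map_mul, map_sub, hθl,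
          hθr, hθC, presentationMap_X_inr, sub_zero, map_X, map_C, Complex.conj_I]
        rw [← mul_assoc, ← C_mul]
        congr 2
        ring
  rw [← hker]
  intro f hf
  have h1 := congrArg (fun g => g f) hcomp
  rw [RingHom.mem_ker] at hf
  simp only [RingHom.comp_apply, RingHom.coe_coe, hf, map_zero] at h1
  exact h1

lemma gammaIdeal_toIdeal (K : Type*) [Field K] : (gammaIdeal K h).toIdeal =
    Ideal.span (X '' Set.range Sum.inl) * Ideal.span (X '' Set.range Sum.inr) := by
  rw [← Set.range_comp, ← Set.range_comp]
  rfl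

/-- The extension of `𝔭` to the complex numbers is `(u_1, …, u_h) (v_1, …, v_h)`: this product is
the intersection of its factors, and its generators `u_j v_k` are complex combinations of
`y_j y_k + z_j z_k` and `z_j y_k - y_j z_k`. -/
lemma map_ker_presentationMap :
    (RingHom.ker (presentationMap h)).map (realToComplex h) = (gammaIdeal ℂ h).toIdeal := by
  rw [gammaIdeal_toIdeal]
  apply le_antisymm
  · rw [span_X_image_mul (Set.isCompl_range_inl_range_inr.disjoint), Ideal.map_le_iff_le_comap,
      Ideal.comap_inf]
    exact le_inf (ker_presentationMap h).le (ker_presentationMap_le h)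
  · rw [Ideal.span_mul_span', Ideal.span_le]
    rintro _ ⟨_, ⟨_, ⟨j, rfl⟩, rfl⟩, _, ⟨_, ⟨k, rfl⟩, rfl⟩, rfl⟩
    have hII := C_I_mul_C_I (σ := Fin h)
    have h1 : (X (Sum.inl j) * X (Sum.inl k) + X (Sum.inr j) * X (Sum.inr k) :
        MvPolynomial (Fin h ⊕ Fin h) ℝ) ∈ RingHom.ker (presentationMap h) := by
      rw [RingHom.mem_ker, map_add, map_mul, map_mul, presentationMap_X_inl, presentationMap_X_inl,
        presentationMap_X_inr, presentationMap_X_inr]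
      linear_combination X j * X k * hII
    have h2 : (X (Sum.inr j) * X (Sum.inl k) - X (Sum.inl j) * X (Sum.inr k) :
        MvPolynomial (Fin h ⊕ Fin h) ℝ) ∈ RingHom.ker (presentationMap h) := by
      rw [RingHom.mem_ker, map_sub, map_mul, map_mul, presentationMap_X_inl, presentationMap_X_inl,
        presentationMap_X_inr, presentationMap_X_inr]
      ring
    have h3 := Ideal.add_mem _ (Ideal.mem_map_of_mem (realToComplex h) h1)
      (Ideal.mul_mem_left _ (C Complex.I) (Ideal.mem_map_of_mem (realToComplex h) h2))
    rw [map_add (realToComplex h), map_sub (realToComplex h), map_mul, map_mul, map_mul,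
      map_mul] at h3
    refine (congrArg (· ∈ Ideal.map _ _) ?_).mpr h3
    change X (Sum.inl j) * X (Sum.inr k) = _
    linear_combination -(X (Sum.inr k) : MvPolynomial (Fin h ⊕ Fin h) ℂ) *
        realToComplex_add h j -
      (realToComplex h (X (Sum.inl j)) + C Complex.I * realToComplex h (X (Sum.inr j))) *
        realToComplex_sub h k -
      realToComplex h (X (Sum.inr j)) * realToComplex h (X (Sum.inr k)) *
        C_I_mul_C_I (σ := Fin h ⊕ Fin h)

end Contraction

/-! ### The height -/

section Height

variable (h : ℕ)

/-- The first `k` of the variables `u_1, …, u_h, v_1, …, v_h`. -/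
def initialVariables (k : ℕ) : Set (Fin h ⊕ Fin h) :=
  {i | Sum.elim (fun j : Fin h => (j : ℕ)) (fun j : Fin h => h + j) i < k}

/-- The contraction to the real polynomial ring of the ideal generated by the first `k` of the
variables `u_1, …, u_h, v_1, …, v_h`. -/
noncomputable def chainIdeal (k : ℕ) : Ideal (MvPolynomial (Fin h ⊕ Fin h) ℝ) :=
  (Ideal.span (X '' initialVariables h k)).comap (realToComplex h)

instance (k : ℕ) : (chainIdeal h k).IsPrime :=
  have := isPrime_span_X_image (K := ℂ) (initialVariables h k)
  Ideal.comap_isPrime _ _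

lemma chainIdeal_lt {k : ℕ} (hk : k < 2 * h) : chainIdeal h k < chainIdeal h (k + 1) := by
  have hprime := isPrime_span_X_image (K := ℂ) (initialVariables h k)
  have hmono : initialVariables h k ⊆ initialVariables h (k + 1) :=
    fun i hi => Nat.lt_succ_of_lt hi
  refine lt_of_le_of_ne (Ideal.comap_mono (Ideal.span_mono (Set.image_mono hmono))) fun heq => ?_
  by_cases hkh : k < h
  · -- The polynomial `y_k ^ 2 + z_k ^ 2` is `u_k v_k`.
    let j : Fin h := ⟨k, hkh⟩
    have h1 : realToComplex h (X (Sum.inl j) ^ 2 + X (Sum.inr j) ^ 2) =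
        X (Sum.inl j) * X (Sum.inr j) := by
      rw [map_add, map_pow, map_pow]
      linear_combination (X (Sum.inr j) : MvPolynomial (Fin h ⊕ Fin h) ℂ) *
          realToComplex_add h j +
        (realToComplex h (X (Sum.inl j)) + C Complex.I * realToComplex h (X (Sum.inr j))) *
          realToComplex_sub h j +
        realToComplex h (X (Sum.inr j)) ^ 2 * C_I_mul_C_I (σ := Fin h ⊕ Fin h)
    have h2 : X (Sum.inl j) ^ 2 + X (Sum.inr j) ^ 2 ∈ chainIdeal h (k + 1) := by
      rw [chainIdeal, Ideal.mem_comap, h1]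
      exact Ideal.mul_mem_right _ _ (X_mem_span_X_image_iff.2 (Nat.lt_succ_self k))
    rw [← heq, chainIdeal, Ideal.mem_comap, h1] at h2
    rcases hprime.mem_or_mem h2 with h3 | h3 <;> rw [X_mem_span_X_image_iff] at h3
    · exact lt_irrefl k h3
    · have : h + k < k := h3
      omega
  · -- The variable `y_j` is `(u_j + v_j) / 2`.
    let j : Fin h := ⟨k - h, by omega⟩
    have hu : Sum.inl j ∈ initialVariables h k := by
      change k - h < k
      omega
    have h2 : X (Sum.inl j) ∈ chainIdeal h (k + 1) := by
      rw [chainIdeal, Ideal.mem_comap, realToComplex_X_inl]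
      refine Ideal.mul_mem_left _ _ (Ideal.add_mem _ (X_mem_span_X_image_iff.2 (hmono hu))
        (X_mem_span_X_image_iff.2 ?_))
      change h + (k - h) < k + 1
      omega
    rw [← heq, chainIdeal, Ideal.mem_comap, realToComplex_X_inl] at h2
    have h3 := Ideal.mul_mem_left _ (C 2) h2
    rw [← mul_assoc, ← C_mul, show (2 * (1 / 2) : ℂ) = 1 by norm_num, C_1, one_mul,
      Ideal.add_mem_iff_right _ (X_mem_span_X_image_iff.2 hu), X_mem_span_X_image_iff] at h3
    have : h + (k - h) < k := h3
    omega

lemma chainIdeal_self : chainIdeal h h = RingHom.ker (presentationMap h) := by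
  rw [ker_presentationMap, chainIdeal]
  congr 3
  ext (j | j)
  · simp [initialVariables]
  · simp [initialVariables]

/-- The prime ideal `𝔭` is the member with index `h` of a chain of `2 h + 1` primes of a ring of
dimension `2 h`. -/
lemma height_ker_presentationMap : (RingHom.ker (presentationMap h)).height = h := by
  have hadd : ∀ k m, k + m ≤ 2 * h →
      (chainIdeal h k).height + m ≤ (chainIdeal h (k + m)).height := by
    intro k m
    induction m with
    | zero => simp
    | succ m ih =>
      intro hm
      have h1 := Ideal.height_add_one_le_of_lt_of_isPrime (chainIdeal_lt h (k := k + m) (by omega))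
      refine le_trans ?_ h1
      rw [Nat.cast_succ, ← add_assoc]
      gcongr
      exact ih (by omega)
  have hdim : (chainIdeal h (2 * h)).height ≤ (2 * h : ℕ) := by
    have h1 := Ideal.height_le_ringKrullDim_of_isPrime (I := chainIdeal h (2 * h))
    rw [MvPolynomial.ringKrullDim_of_isNoetherianRing, ringKrullDim_eq_zero_of_field, zero_add,
      Nat.card_eq_fintype_card, Fintype.card_sum, Fintype.card_fin, ← two_mul] at h1
    exact WithBot.coe_le_coe.1 h1
  rw [← chainIdeal_self]
  apply le_antisymm
  · have h1 := (hadd h h (by omega)).trans (two_mul h ▸ hdim)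
    rw [Nat.cast_add] at h1
    exact (ENat.add_le_add_iff_right (ENat.natCast_ne_top h)).1 h1
  · have h1 := hadd 0 h (by omega)
    rw [zero_add] at h1
    exact le_add_self.trans h1

end Height

/-! ### The Betti numbers -/

section Betti

variable (h : ℕ)

/-- The set of the variables `u_1, …, u_h`. -/
def uVariables : Finset (Fin h ⊕ Fin h) := Finset.univ.map Function.Embedding.inl

lemma ideal_mixedResolution_uVariables (K : Type*) [Field K] :
    (mixedResolution K (uVariables h)).ideal = (gammaIdeal K h).toIdeal := by
  rw [ideal_mixedResolution, gammaIdeal_toIdeal]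
  have h1 : (uVariables h : Set (Fin h ⊕ Fin h)) = Set.range Sum.inl := by
    ext
    simp [uVariables]
  rw [h1, Set.compl_range_inl]

lemma card_isCell_uVariables (n : ℕ) :
    (Fintype.card {A // IsCell (uVariables h) (n + 1) A} : ℤ) =
      ((2 * h).choose (n + 2) : ℤ) - 2 * (h.choose (n + 2) : ℤ) := by
  have h1 := card_isCell_add (U := uVariables h) n
  have h2 : (uVariables h).card = h := by simp [uVariables]
  have h3 : (uVariables h)ᶜ.card = h := by
    rw [Finset.card_compl, h2]
    simp
  rw [h2, h3, Fintype.card_sum, Fintype.card_fin, ← two_mul h] at h1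
  omega

lemma constantCoeff_eq_zero_of_mem_gammaIdeal {K : Type*} [Field K]
    {f : MvPolynomial (Fin h ⊕ Fin h) K} (hf : f ∈ (gammaIdeal K h).toIdeal) :
    constantCoeff f = 0 := by
  rw [gammaIdeal_toIdeal] at hf
  have h1 := mem_ideal_span_X_image.1 (Ideal.mul_le_left hf)
  rw [constantCoeff_eq]
  by_contra h2
  obtain ⟨i, -, hi⟩ := h1 0 (mem_support_iff.2 h2)
  exact hi rfl

lemma GradedFreeResolution.gen_mem {σ K : Type*} [Field K] {I : Ideal (MvPolynomial σ K)}
    (F : GradedFreeResolution I) (a : Fin (F.rank 0)) : F.gen a ∈ I := by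
  have h1 : F.gen a ∈ Ideal.span (Set.range F.gen) := Ideal.subset_span ⟨a, rfl⟩
  rwa [F.span_gen] at h1

lemma finrank_tor_gammaIdeal {K : Type*} [Field K]
    (F : GradedFreeResolution (gammaIdeal K h).toIdeal) (i : ℕ) (j : ℤ) :
    Module.finrank K (F.Tor i j) =
      if j = i + 2 then Fintype.card {A // IsCell (uVariables h) (i + 1) A} else 0 := by
  have h1 := CyclicResolution.card_strand_eq (E := F.toCyclic)
    (G := mixedResolution K (uVariables h))
    (F.ideal_toCyclic.trans (ideal_mixedResolution_uVariables h K).symm)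
    constantCoeff_mixedD i j
  have h2 := F.finrank_tor_add
    (fun a => constantCoeff_eq_zero_of_mem_gammaIdeal h (F.gen_mem a)) i j
  rw [card_strand_mixedResolution] at h1
  omega

lemma finrank_tor_ker_presentationMap
    (F : GradedFreeResolution (RingHom.ker (presentationMap h))) (i : ℕ) :
    Module.finrank ℝ (F.Tor i (i + 2)) =
      Fintype.card {A // IsCell (uVariables h) (i + 1) A} := by
  have hφ := isComplexification_realToComplex h
  have h1 := CyclicResolution.card_strand_eq (E := F.toCyclic.map hφ)
    (G := mixedResolution ℂ (uVariables h))
    (by rw [CyclicResolution.ideal_map, F.ideal_toCyclic, ideal_mixedResolution_uVariables,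
      map_ker_presentationMap])
    constantCoeff_mixedD i (i + 2)
  rw [card_strand_mixedResolution, if_pos rfl, CyclicResolution.rank_strandD_map,
    CyclicResolution.rank_strandD_map] at h1
  have h2 := F.finrank_tor_add (fun a => by
    have h3 := Ideal.mem_map_of_mem (realToComplex h) (F.gen_mem a)
    rw [map_ker_presentationMap] at h3
    have h4 := constantCoeff_eq_zero_of_mem_gammaIdeal h h3
    rw [hφ.constantCoeff] at h4
    exact (map_eq_zero _).1 h4) i (i + 2)
  have h5 : Fintype.card {a // (F.toCyclic.map hφ).deg (i + 1) a = (i : ℤ) + 2} =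
    Fintype.card {a // F.toCyclic.deg (i + 1) a = (i : ℤ) + 2} := rfl
  omega

end Betti

theorem corollary4p1 (h : ℕ) (hh : 1 ≤ h) :
    ∃ P : HomogeneousIdeal (homogeneousSubmodule (Fin h ⊕ Fin h) ℝ),
      P.toIdeal = RingHom.ker (presentationMap h) ∧
      P.toIdeal.IsPrime ∧
      P.toIdeal.height = (h : ℕ∞) ∧
      (∀ i : ℕ, (gradedBetti P i ((i : ℤ) + 2) : ℤ) =
        ((2 * h).choose (i + 2) : ℤ) - 2 * (h.choose (i + 2) : ℤ)) ∧
      (∃ e : MvPolynomial (Fin h ⊕ Fin h) ℂ ≃ₐ[ℂ] MvPolynomial (Fin h ⊕ Fin h) ℂ,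
        (∀ j : Fin h, e (X (Sum.inl j) + C Complex.I * X (Sum.inr j)) = X (Sum.inl j)) ∧
        (∀ j : Fin h, e (X (Sum.inl j) - C Complex.I * X (Sum.inr j)) = X (Sum.inr j)) ∧
        (P.toIdeal.map (MvPolynomial.map (algebraMap ℝ ℂ))).map e =
          (gammaIdeal ℂ h).toIdeal) ∧
      HasLinearResolution (gammaIdeal ℂ h) 2 := by
  let P : HomogeneousIdeal (homogeneousSubmodule (Fin h ⊕ Fin h) ℝ) :=
    ⟨RingHom.ker (presentationMap h), by
      rw [ker_presentationMap]
      exact isHomogeneous_comap_realToComplex h (isHomogeneous_span_X_image _)⟩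
  refine ⟨P, rfl, RingHom.ker_isPrime (presentationMap h), height_ker_presentationMap h,
    fun i => ?_, ⟨coordChange h, toUV_add h, toUV_sub h, ?_⟩, fun i j hij => ?_⟩
  · rw [← card_isCell_uVariables]
    exact congrArg _ (finrank_tor_ker_presentationMap h _ i)
  · rw [← map_ker_presentationMap]
    exact Ideal.map_map _ _
  · exact (finrank_tor_gammaIdeal h _ i j).trans (if_neg hij)
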